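/- An instance of the repair problem consists of $G$ generators, $T$ time periods $1,\dots,T$, for each generator $g$ a minimum run time $U_g\in\mathbb{N}$ and a minimum down time $D_g\in\mathbb{N}$ (counted in periods), an initial on/off status $u_{g0}\in\{0,1\}$, the number $\tau_g\in\mathbb{N}$ of periods for which $g$ has already been in that status, and must-run flags $m_{gt}\in\{0,1\}$; and of a matrix of predicted commitments $\tilde{\mathbf{x}}\in\{0,1\}^{G\times T}$. The feasible commitment set $\mathcal{X}$ is the set of binary vectors $\mathbf{x}=(u,v,w)$ of commitment, startup and shutdown variables, each indexed by $(g,t)$, such that for every generator $g$: - $v_{gt}=1$ if and only if $u_{g,t-1}=0$ and $u_{gt}=1$; and $w_{gt}=1$ if and only if $u_{g,t-1}=1$ and $u_{gt}=0$; - if $v_{gt}=1$, then $u_{gs}=1$ for all $s\le T$ with $t\le s<t+U_g$; if $w_{gt}=1$, then $u_{gs}=0$ for all $s\le T$ with $t\le s<t+D_g$; - if $u_{g0}=1$, then $u_{gs}=1$ for all $1\le s\le \min(T,\,U_g-\tau_g)$; if $u_{g0}=0$, then $u_{gs}=0$ for all $1\le s\le \min(T,\,D_g-\tau_g)$; - $u_{gt}=1$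 whenever $m_{gt}=1$. The repair problem is $\min_{\mathbf{x}\in\mathcal{X}}\mathcal{H}(\mathbf{x},\tilde{\mathbf{x}})$, where $\mathcal{H}(\mathbf{x},\tilde{\mathbf{x}})$ is the Hamming distance between the commitments and the predicted commitments, i.e. the number of pairs $(g,t)$ with $u_{gt}\neq\tilde{x}_{gt}$. **Theorem 1.** The repair problem can be solved in polynomial time: there is a Turing machine that, for every instance, outputs an optimal solution of the repair problem if $\mathcal{X}\neq\emptyset$, and reports infeasibility if $\mathcal{X}=\emptyset$, in a number of steps that is polynomial in the length of the instance, with all numbers written in binary. -/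

import Mathlib

/-- The commitment data of one generator over a horizon of `T` time periods.  All durations are
counted in time periods. -/
structure Generator (T : ℕ) where
  /-- minimum run (up) time -/
  minRun : ℕ
  /-- minimum down time -/
  minDown : ℕ
  /-- whether the generator is on just before the first period -/
  initOn : Bool
  /-- for how many periods it has already been in that initial status -/
  initTime : ℕ
  /-- the periods in which the generator must run -/
  mustRun : Fin T → Bool

/-- An input of the repair problem: `G` generators, `T` time periods, the commitment data of every
generator, and the predicted binary commitments. -/
structure RepairInstance where
  G : ℕ
  T : ℕ
  gen : Fin G → Generator T
  pred : Fin G → Fin T → Bool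

/-- A vector of binary commitment, startup and shutdown variables. -/
@[ext]
structure CommitmentVector (G T : ℕ) where
  commit : Fin G → Fin T → Bool
  startup : Fin G → Fin T → Bool
  shutdown : Fin G → Fin T → Bool

/-- The status of a generator in the period before `t`, when its commitments are `u`. -/
def Generator.statusBefore {T : ℕ} (γ : Generator T) (u : Fin T → Bool) (t : Fin T) : Bool :=
  if (t : ℕ) = 0 then γ.initOn else u ⟨(t : ℕ) - 1, lt_of_le_of_lt (Nat.sub_le _ _) t.isLt⟩

/-- The commitment constraints of a single generator, for its commitments `u`, startups `v` and
shutdowns `w`.  A minimum run or down time that reaches beyond the horizon only binds within it. -/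
structure Generator.Feasible {T : ℕ} (γ : Generator T) (u v w : Fin T → Bool) : Prop where
  /-- a startup is a change from off to on -/
  startup_iff : ∀ t, v t = true ↔ γ.statusBefore u t = false ∧ u t = true
  /-- a shutdown is a change from on to off -/
  shutdown_iff : ∀ t, w t = true ↔ γ.statusBefore u t = true ∧ u t = false
  /-- after a startup the generator stays on for `minRun` periods -/
  min_run : ∀ t s : Fin T, v t = true → (t : ℕ) ≤ s → (s : ℕ) < t + γ.minRun → u s = true
  /-- after a shutdown the generator stays off for `minDown` periods -/
  min_down : ∀ t s : Fin T, w t = true → (t : ℕ) ≤ s → (s : ℕ) < t + γ.minDown → u s = false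
  /-- a generator that is initially on completes its minimum run time -/
  init_run : γ.initOn = true → ∀ s : Fin T, γ.initTime + (s : ℕ) < γ.minRun → u s = true
  /-- a generator that is initially off completes its minimum down time -/
  init_down : γ.initOn = false → ∀ s : Fin T, γ.initTime + (s : ℕ) < γ.minDown → u s = false
  /-- must-run commitments -/
  must_run : ∀ t, γ.mustRun t = true → u t = true

/-- The feasible commitment set `𝒳` of an instance. -/
def RepairInstance.feasibleSet (I : RepairInstance) : Set (CommitmentVector I.G I.T) :=
  {x | ∀ g, (I.gen g).Feasible (x.commit g) (x.startup g) (x.shutdown g)}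

/-- The Hamming distance between the commitments in `x` and the predicted commitments: the number
of pairs (generator, period) at which they differ. -/
def RepairInstance.distance (I : RepairInstance) (x : CommitmentVector I.G I.T) : ℕ :=
  hammingDist (Function.uncurry x.commit) (Function.uncurry I.pred)

/-- The optimal solutions of the repair problem: the minimisers over `𝒳` of the Hamming distance to
the prediction. -/
def RepairInstance.optimalSet (I : RepairInstance) : Set (CommitmentVector I.G I.T) :=
  {x | x ∈ I.feasibleSet ∧ ∀ y ∈ I.feasibleSet, I.distance x ≤ I.distance y}

/-- The (finite) input alphabet. -/
inductive InSymbol where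
  /-- a binary digit of a number -/
  | bit (b : Bool)
  /-- the initial status of a generator -/
  | status (on : Bool)
  /-- the must-run flag and the predicted commitment of one generator in one period -/
  | period (mustRun pred : Bool)
  /-- end mark -/
  | endMark
  deriving DecidableEq, Fintype

/-- The (finite) output alphabet. -/
inductive OutSymbol where
  /-- the three variables of one generator in one period -/
  | period (commit startup shutdown : Bool)
  /-- end mark -/
  | endMark
  /-- there is no feasible solution -/
  | infeasible
  deriving DecidableEq, Fintype

/-- Binary digits of a natural number, least significant digit first, and an end mark. -/
def encodeNumber (n : ℕ) : List InSymbol :=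
  n.bits.map InSymbol.bit ++ [InSymbol.endMark]

/-- The description of one generator and of the commitments predicted for it. -/
def encodeGenerator {T : ℕ} (γ : Generator T) (p : Fin T → Bool) : List InSymbol :=
  InSymbol.status γ.initOn ::
    (encodeNumber γ.minRun ++ encodeNumber γ.minDown ++ encodeNumber γ.initTime ++
      List.ofFn (fun t => InSymbol.period (γ.mustRun t) (p t)) ++ [InSymbol.endMark])

/-- The input string of an instance, with all numbers written in binary. -/
def RepairInstance.encode (I : RepairInstance) : List InSymbol :=
  encodeNumber I.T ++ (List.ofFn fun g => encodeGenerator (I.gen g) (I.pred g)).flatten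

/-- The output string of a commitment vector. -/
def CommitmentVector.encode {G T : ℕ} (x : CommitmentVector G T) : List OutSymbol :=
  (List.ofFn fun g =>
    List.ofFn (fun t => OutSymbol.period (x.commit g t) (x.startup g t) (x.shutdown g t)) ++
      [OutSymbol.endMark]).flatten

/-- The output string of an answer: a commitment vector, or the report that there is none. -/
def encodeAnswer {G T : ℕ} : Option (CommitmentVector G T) → List OutSymbol
  | none => [OutSymbol.infeasible]
  | some x => x.encode

/-! The Hamming distance is a sum over generators and every constraint concerns a single generator,
so the generators can be treated separately (`distance_eq_sum`). For one generator, the startups and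
shutdowns are determined by the commitments. Apart from the must-run flags, feasibility can be
checked period by period with the state (`b`, `r`), where `b` is the status and `r` the number of
periods for which it is still forced: a change requires `r = 0`, and a change to `c` resets `r` to
`M c - 1`, where `M c` is the minimum duration of `c` (`admissible_iff`, `feasible_iff`).

While `r` is positive there is no choice, so a policy needs only one decision per period and status.
These decisions are found by dynamic programming from the last period on: staying and changing are
compared, each continued by the policy already planned for the later periods (`decision_spec`).
Bellman's argument, `visitCost_follow_le`, shows that the resulting schedule is at least as cheap as
any admissible one, a violated must-run flag having infinite cost. An infinite cost of the schedule
therefore proves infeasibility, and a finite one makes it optimal.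

No table of values is kept: the two alternatives are evaluated by simulating them. Durations can be
exponential in the input length, so they stay in binary and a counter is decremented once per
period. The periods of every generator are listed in the input, so the horizon is at most the length
of each generator's description. Planning a generator takes O(T) simulations of O(T) periods, each
period linear in the number of digits, which is cubic in all.

The algorithm is written as a stack program. Sequencing and iteration of programs come with bounds
on the running time, and `computableInPolyTime` turns the program into a Turing machine. -/

open Function

/-! ### Stack programs, their composition and their running times -/

/-- An instruction of a machine with stacks of symbols `Γ k` that continues at a point of `X`. -/
inductive StackInstr {K : Type} (Γ : K → Type) (X : Type) : Type
  | push (k : K) (x : Γ k) (next : X)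
  | pop (k : K) (next : Option (Γ k) → X)
  | jump (next : X)

namespace StackInstr

variable {K : Type} {Γ : K → Type} {X Y : Type}

/-- Rename the points at which an instruction may continue. -/
def map (f : X → Y) : StackInstr Γ X → StackInstr Γ Y
  | push k x n => push k x (f n)
  | pop k n => pop k (fun o => f (n o))
  | jump n => jump (f n)

/-- The effect of an instruction. -/
def exec [DecidableEq K] : StackInstr Γ X → (∀ k, List (Γ k)) → X × (∀ k, List (Γ k))
  | push k x n, S => (n, update S k (x :: S k))
  | pop k n, S => (n (S k).head?, update S k (S k).tail)
  | jump n, S => (n, S)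

theorem exec_map [DecidableEq K] (f : X → Y) (i : StackInstr Γ X) (S : ∀ k, List (Γ k)) :
    (i.map f).exec S = (f (i.exec S).1, (i.exec S).2) := by
  cases i <;> rfl

end StackInstr

/-- A program fragment: a finite control with an entry point and exits labelled by `α`. -/
structure StackProgram {K : Type} (Γ : K → Type) (α : Type) : Type 1 where
  /-- the control points -/
  Point : Type
  finite_point : Finite Point
  /-- the instruction at each control point -/
  code : Point → StackInstr Γ (Point ⊕ α)
  /-- the entry point -/
  entry : Point ⊕ α

attribute [instance] StackProgram.finite_point

namespace StackProgram

variable {K : Type} [DecidableEq K] {Γ : K → Type} {α β P Q : Type}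

/-- Execution of exactly `n` instructions. -/
inductive Steps (code : P → StackInstr Γ (P ⊕ α)) :
    P ⊕ α → (∀ k, List (Γ k)) → ℕ → P ⊕ α → (∀ k, List (Γ k)) → Prop
  | refl (x S) : Steps code x S 0 x S
  | step {l S n z S'} (h : Steps code ((code l).exec S).1 ((code l).exec S).2 n z S') :
      Steps code (Sum.inl l) S (n + 1) z S'

theorem Steps.trans {code : P → StackInstr Γ (P ⊕ α)} {x y z S S' S'' n m}
    (h : Steps code x S n y S') (h' : Steps code y S' m z S'') :
    Steps code x S (n + m) z S'' := by
  induction h with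
  | refl => simpa using h'
  | step _ ih =>
    rw [Nat.add_right_comm]
    exact .step (ih h')

/-- A fragment runs inside a larger program as it does alone, provided its code is copied with
renamed points and its exits are redirected. Sequencing and iteration both rest on this. -/
theorem Steps.embed {code : P → StackInstr Γ (P ⊕ α)} {code' : Q → StackInstr Γ (Q ⊕ β)}
    (e : P → Q) (exit : α → Q ⊕ β)
    (he : ∀ l, code' (e l) = (code l).map (Sum.elim (Sum.inl ∘ e) exit)) {x y S S' n}
    (h : Steps code x S n y S') :
    Steps code' (Sum.elim (Sum.inl ∘ e) exit x) S n (Sum.elim (Sum.inl ∘ e) exit y) S' := by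
  induction h with
  | refl => exact .refl _ _
  | step _ ih =>
    refine .step ?_
    rw [he, StackInstr.exec_map]
    exact ih

/-- The program leaves through the exit `a` with stacks `S'` after at most `n` instructions. -/
def Runs (M : StackProgram Γ α) (S : ∀ k, List (Γ k)) (n : ℕ) (a : α) (S' : ∀ k, List (Γ k)) :
    Prop :=
  ∃ m ≤ n, Steps M.code M.entry S m (Sum.inr a) S'

theorem Runs.mono {M : StackProgram Γ α} {S S' n m a} (h : Runs M S n a S') (hnm : n ≤ m) :
    Runs M S m a S' :=
  let ⟨k, hk, hs⟩ := h
  ⟨k, hk.trans hnm, hs⟩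

/-- Do nothing. -/
def ret (a : α) : StackProgram Γ α where
  Point := Empty
  finite_point := inferInstance
  code := Empty.elim
  entry := Sum.inr a

theorem runs_ret (a : α) (S : ∀ k, List (Γ k)) (n : ℕ) : Runs (ret a) S n a S :=
  ⟨0, n.zero_le, .refl _ _⟩

/-- Push a symbol. -/
def push (k : K) (x : Γ k) : StackProgram Γ Unit where
  Point := Unit
  finite_point := inferInstance
  code _ := .push k x (Sum.inr ())
  entry := Sum.inl ()

theorem runs_push (k : K) (x : Γ k) (S : ∀ k, List (Γ k)) :
    Runs (push k x) S 1 () (update S k (x :: S k)) :=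
  ⟨1, le_rfl, .step (.refl _ _)⟩

/-- Pop a symbol and return it. -/
def pop (k : K) : StackProgram Γ (Option (Γ k)) where
  Point := Unit
  finite_point := inferInstance
  code _ := .pop k Sum.inr
  entry := Sum.inl ()

theorem runs_pop (k : K) (S : ∀ k, List (Γ k)) :
    Runs (pop k) S 1 (S k).head? (update S k (S k).tail) :=
  ⟨1, le_rfl, .step (.refl _ _)⟩

/-- Sequential composition. -/
def bind [Finite α] (p : StackProgram Γ α) (q : α → StackProgram Γ β) : StackProgram Γ β where
  Point := p.Point ⊕ Σ a, (q a).Point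
  finite_point := inferInstance
  code
    | Sum.inl l => (p.code l).map (Sum.elim (Sum.inl ∘ Sum.inl)
        fun a => Sum.elim (Sum.inl ∘ fun l => Sum.inr ⟨a, l⟩) Sum.inr (q a).entry)
    | Sum.inr ⟨a, l⟩ => ((q a).code l).map (Sum.elim (Sum.inl ∘ fun l => Sum.inr ⟨a, l⟩) Sum.inr)
  entry := Sum.elim (Sum.inl ∘ Sum.inl)
    (fun a => Sum.elim (Sum.inl ∘ fun l => Sum.inr ⟨a, l⟩) Sum.inr (q a).entry) p.entry

theorem Runs.bind [Finite α] {p : StackProgram Γ α} {q : α → StackProgram Γ β}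
    {S S' S'' n m a b} (hp : Runs p S n a S') (hq : Runs (q a) S' m b S'') :
    Runs (p.bind q) S (n + m) b S'' := by
  obtain ⟨n', hn, hp⟩ := hp
  obtain ⟨m', hm, hq⟩ := hq
  refine ⟨n' + m', by omega, ?_⟩
  have h₁ := hp.embed (code' := (p.bind q).code) Sum.inl
    (fun a => Sum.elim (Sum.inl ∘ fun l => Sum.inr ⟨a, l⟩) Sum.inr (q a).entry) (fun _ => rfl)
  have h₂ := hq.embed (code' := (p.bind q).code) (fun l => Sum.inr ⟨a, l⟩) Sum.inr (fun _ => rfl)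
  exact h₁.trans h₂

/-- Iteration: the body is repeated as long as it returns a new loop state. -/
def loop [Finite β] (body : β → StackProgram Γ (β ⊕ α)) (b : β) : StackProgram Γ α where
  Point := β ⊕ Σ b, (body b).Point
  finite_point := inferInstance
  code
    | Sum.inl b => .jump (Sum.elim (Sum.inl ∘ fun l => Sum.inr ⟨b, l⟩)
        (Sum.elim (fun b' => Sum.inl (Sum.inl b')) Sum.inr) (body b).entry)
    | Sum.inr ⟨b, l⟩ => ((body b).code l).map (Sum.elim (Sum.inl ∘ fun l => Sum.inr ⟨b, l⟩)
        (Sum.elim (fun b' => Sum.inl (Sum.inl b')) Sum.inr))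
  entry := Sum.inl (Sum.inl b)

theorem Runs.loop_exit [Finite β] {body : β → StackProgram Γ (β ⊕ α)} {b S S' n a}
    (h : Runs (body b) S n (Sum.inr a) S') : Runs (loop body b) S (n + 1) a S' := by
  obtain ⟨n', hn, h⟩ := h
  -- The additional instruction is the jump from the loop head into the body.
  refine ⟨n' + 1, by omega, .step ?_⟩
  exact h.embed (code' := (loop body b).code) (fun l => Sum.inr ⟨b, l⟩)
    (Sum.elim (fun b' => Sum.inl (Sum.inl b')) Sum.inr) (fun _ => rfl)

theorem Runs.loop_next [Finite β] {body : β → StackProgram Γ (β ⊕ α)} {b b' S S' S'' n m a}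
    (h : Runs (body b) S n (Sum.inl b') S') (h' : Runs (loop body b') S' m a S'') :
    Runs (loop body b) S (n + 1 + m) a S'' := by
  obtain ⟨n', hn, h⟩ := h
  obtain ⟨m', hm, h'⟩ := h'
  refine ⟨n' + 1 + m', by omega, Steps.trans (.step ?_) h'⟩
  exact h.embed (code' := (loop body b).code) (fun l => Sum.inr ⟨b, l⟩)
    (Sum.elim (fun b' => Sum.inl (Sum.inl b')) Sum.inr) (fun _ => rfl)

/-- Move the content of one stack onto another, symbol by symbol. -/
def move (j k : K) [Finite (Γ j)] (f : Γ j → Γ k) : StackProgram Γ Unit :=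
  loop (β := Unit) (fun _ => (pop j).bind fun
    | none => ret (Sum.inr ())
    | some x => (push k (f x)).bind fun _ => ret (Sum.inl ())) ()

/-- Three instructions per symbol: the jump at the loop head, the pop and the push. The last two are
the jump and the pop that finds the stack empty. -/
theorem runs_move {j k : K} (hjk : j ≠ k) [Finite (Γ j)] (f : Γ j → Γ k) (S : ∀ k, List (Γ k)) :
    Runs (move j k f) S (3 * (S j).length + 2) ()
      (update (update S j []) k (((S j).map f).reverse ++ S k)) := by
  generalize h : S j = l
  induction l generalizing S with
  | nil =>
    have h₁ := runs_pop j S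
    rw [h] at h₁
    have e : update (update S j []) k (((([] : List (Γ j)).map f).reverse) ++ S k) =
        update S j [] := by
      rw [update_eq_iff]
      simp [update_of_ne hjk.symm]
    rw [e]
    exact Runs.mono (Runs.loop_exit (Runs.bind h₁ (runs_ret _ _ 0))) (by simp)
  | cons x l ih =>
    have h₁ := runs_pop j S
    rw [h] at h₁
    have h₂ := runs_push k (f x) (update S j l)
    have h₃ := ih (update (update S j l) k (f x :: update S j l k)) (by simp [update_of_ne hjk])
    have e : update (update S j []) k (((x :: l).map f).reverse ++ S k) =
        update (update (update (update S j l) k (f x :: update S j l k)) j []) k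
          ((l.map f).reverse ++ update (update S j l) k (f x :: update S j l k) k) := by
      rw [update_comm hjk.symm (f x :: update S j l k) [] (update S j l)]
      simp [update_of_ne hjk.symm]
    rw [e]
    exact Runs.mono (Runs.loop_next (Runs.bind h₁ (Runs.bind h₂ (runs_ret _ _ 0))) h₃)
      (by simp; omega)

/-- Empty a stack. -/
def drain (k : K) [Finite (Γ k)] : StackProgram Γ Unit :=
  loop (β := Unit) (fun _ => (pop k).bind fun
    | none => ret (Sum.inr ())
    | some _ => ret (Sum.inl ())) ()

theorem runs_drain (k : K) [Finite (Γ k)] (S : ∀ k, List (Γ k)) :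
    Runs (drain k) S (2 * (S k).length + 2) () (update S k []) := by
  generalize h : S k = l
  induction l generalizing S with
  | nil =>
    have h₁ := runs_pop k S
    rw [h] at h₁
    exact Runs.mono (Runs.loop_exit (Runs.bind h₁ (runs_ret _ _ 0))) (by simp)
  | cons x l ih =>
    have h₁ := runs_pop k S
    rw [h] at h₁
    have h₃ := ih (update S k l) (by simp)
    rw [update_idem] at h₃
    exact Runs.mono (Runs.loop_next (Runs.bind h₁ (runs_ret _ _ 0)) h₃) (by simp; omega)

/-! ### Translation into Turing machines -/

section TM2

open Turing

/-- The statement of a Turing machine that executes an instruction.  The machine variable holds the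
point at which to continue. -/
def _root_.StackInstr.toStmt {X : Type} : StackInstr Γ X → TM2.Stmt Γ X X
  | .push k x n => .push k (fun _ => x) (.goto fun _ => n)
  | .pop k n => .pop k (fun _ o => n o) (.goto id)
  | .jump n => .goto fun _ => n

theorem _root_.StackInstr.stepAux_toStmt {X : Type} (i : StackInstr Γ X) (v : X)
    (S : ∀ k, List (Γ k)) :
    ∃ v', TM2.stepAux i.toStmt v S = ⟨some (i.exec S).1, v', (i.exec S).2⟩ := by
  cases i <;> exact ⟨_, rfl⟩

/-- The statements of the Turing machine that executes a program. -/
def toStmt (M : StackProgram Γ Unit) :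
    M.Point ⊕ Unit → TM2.Stmt Γ (M.Point ⊕ Unit) (M.Point ⊕ Unit)
  | Sum.inl l => (M.code l).toStmt
  -- `haltList` prescribes the initial value of the machine variable, so it is restored before
  -- halting.
  | Sum.inr _ => .load (fun _ => M.entry) .halt

/-- The Turing machine that executes a program. -/
noncomputable def toTM2 [Fintype K] (M : StackProgram Γ Unit) (k₀ k₁ : K) [Fintype (Γ k₀)] :
    FinTM2 where
  K := K
  k₀ := k₀
  k₁ := k₁
  Γ := Γ
  Λ := M.Point ⊕ Unit
  main := M.entry
  ΛFin := Fintype.ofFinite _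
  σ := M.Point ⊕ Unit
  initialState := M.entry
  σFin := Fintype.ofFinite _
  m := M.toStmt

/-- One instruction is one machine step. The variable only carries the continuation chosen by a pop
to the following `goto`, so its value between steps is irrelevant. -/
theorem Steps.toTM2 {M : StackProgram Γ Unit} {x y S S' n} (h : Steps M.code x S n y S')
    (v : M.Point ⊕ Unit) :
    ∃ v', (flip Option.bind (TM2.step M.toStmt))^[n] (some ⟨some x, v, S⟩) =
      some ⟨some y, v', S'⟩ := by
  induction h generalizing v with
  | refl => exact ⟨v, rfl⟩
  | @step l S n z S' _ ih =>
    obtain ⟨v', hv'⟩ := (M.code l).stepAux_toStmt v S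
    obtain ⟨v'', hv''⟩ := ih v'
    refine ⟨v'', ?_⟩
    rw [← hv'', ← hv']
    rfl

/-- A program that computes `f` within polynomial time yields a Turing machine doing so. -/
theorem computableInPolyTime [Fintype K] (M : StackProgram Γ Unit) (k₀ k₁ : K) [Fintype (Γ k₀)]
    {A : Type} (ea : A → List (Γ k₀)) (f : A → List (Γ k₁)) (time : Polynomial ℕ)
    (h : ∀ a, Runs M (update (fun _ => []) k₀ (ea a)) (time.eval (ea a).length) ()
      (update (fun _ => []) k₁ (f a))) :
    Nonempty (TM2ComputableInPolyTime ea (id : List (Γ k₁) → List (Γ k₁)) f) := by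
  -- The additional step is the halting statement executed at the exit.
  refine ⟨⟨⟨M.toTM2 k₀ k₁, Equiv.refl _, Equiv.refl _⟩, time + 1, fun a => ?_⟩⟩
  refine Classical.choice ?_
  obtain ⟨n, hn, hs⟩ := h a
  obtain ⟨v, hv⟩ := hs.toTM2 M.entry
  -- `initList` and `haltList` give the stacks by a case distinction with a cast along `k = j`.
  have key (j : K) (l : List (Γ j)) : (fun k : K => @dite (List (Γ k)) (k = j) _
      (fun h => by rw [h]; exact l) fun _ => []) = update (fun _ => []) j l := by
    funext k
    by_cases hk : k = j
    · subst hk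
      simp
    · simp [hk]
  have hi : initList (M.toTM2 k₀ k₁) (List.map (Equiv.refl (Γ k₀)).invFun (ea a)) =
      (⟨some M.entry, M.entry, update (fun _ => []) k₀ (ea a)⟩ :
        TM2.Cfg Γ (M.Point ⊕ Unit) (M.Point ⊕ Unit)) := by
    rw [← key]
    exact congrArg (initList (M.toTM2 k₀ k₁)) (List.map_id _)
  have hf : haltList (M.toTM2 k₀ k₁) (List.map (Equiv.refl (Γ k₁)).invFun (f a)) =
      (⟨none, M.entry, update (fun _ => []) k₁ (f a)⟩ :
        TM2.Cfg Γ (M.Point ⊕ Unit) (M.Point ⊕ Unit)) := by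
    rw [← key]
    exact congrArg (haltList (M.toTM2 k₀ k₁)) (List.map_id _)
  have hv' : (flip Option.bind (TM2.step M.toStmt))^[n + 1]
      (some ⟨some M.entry, M.entry, update (fun _ => []) k₀ (ea a)⟩) =
      some ⟨none, M.entry, update (fun _ => []) k₁ (f a)⟩ := by
    rw [iterate_succ_apply', hv]
    rfl
  refine ⟨⟨⟨n + 1, ?_⟩, by simpa using hn⟩⟩
  have e := congrArg (fun c => (flip Option.bind (M.toTM2 k₀ k₁).step)^[n + 1] (some c)) hi
  exact e.trans (hv'.trans (congrArg some hf.symm))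

end TM2

end StackProgram

/-! ### The stacks of the machine and its programs -/

namespace RepairMachine

/-- A period of a generator with its must-run flag, its predicted commitment, and a policy: whether
to change the status in this period, given the status before, when it is free to change. -/
abbrev PlanItem := (Bool × Bool) × (Bool → Bool)

/-- A period with the statuses before and in it. -/
abbrev Visit := PlanItem × Bool × Bool

/-- The stacks of the machine. -/
inductive Stack
  /-- the input -/
  | inp
  /-- the output -/
  | out
  /-- the minimum durations `some b` of the statuses `b`, and the initial time `none` -/
  | num (j : Option Bool)
  /-- the remaining number of periods for which the status is forced -/
  | rem
  /-- auxiliary digits of decrementation and copying -/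
  | tmp
  /-- digits of a difference -/
  | digits
  /-- the periods still to be planned, the last one on top -/
  | todo
  /-- the planned periods, the first one on top -/
  | plan
  /-- the visited periods, the last one on top -/
  | trail
  /-- a unary number -/
  | cnt
  /-- the reversed output -/
  | acc
  deriving DecidableEq, Fintype

/-- The alphabets of the stacks. -/
@[reducible] def Sym : Stack → Type
  | .inp => InSymbol
  | .out => OutSymbol
  | .num _ => Bool
  | .rem => Bool
  | .tmp => Bool
  | .digits => Bool
  | .todo => Bool × Bool
  | .plan => PlanItem
  | .trail => Visit
  | .cnt => Unit
  | .acc => OutSymbol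

instance (k : Stack) : Finite (Sym k) := by
  cases k <;> infer_instance

/-- The contents of the stacks. -/
structure Store where
  inp : List InSymbol := []
  out : List OutSymbol := []
  num : Option Bool → List Bool := fun _ => []
  rem : List Bool := []
  tmp : List Bool := []
  digits : List Bool := []
  todo : List (Bool × Bool) := []
  plan : List PlanItem := []
  trail : List Visit := []
  cnt : List Unit := []
  acc : List OutSymbol := []

namespace Store

/-- The content of a stack. -/
def get (s : Store) : ∀ k, List (Sym k)
  | .inp => s.inp
  | .out => s.out
  | .num j => s.num j
  | .rem => s.rem
  | .tmp => s.tmp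
  | .digits => s.digits
  | .todo => s.todo
  | .plan => s.plan
  | .trail => s.trail
  | .cnt => s.cnt
  | .acc => s.acc

/-- Replace the content of a stack. -/
def set (s : Store) : ∀ k, List (Sym k) → Store
  | .inp, l => { s with inp := l }
  | .out, l => { s with out := l }
  | .num j, l => { s with num := update s.num j l }
  | .rem, l => { s with rem := l }
  | .tmp, l => { s with tmp := l }
  | .digits, l => { s with digits := l }
  | .todo, l => { s with todo := l }
  | .plan, l => { s with plan := l }
  | .trail, l => { s with trail := l }
  | .cnt, l => { s with cnt := l }
  | .acc, l => { s with acc := l }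

/-- Links the record of stack contents, on which `simp` computes, to the dependent functions on
which programs act. -/
theorem get_set (s : Store) (k : Stack) (l : List (Sym k)) : (s.set k l).get = update s.get k l := by
  funext j
  by_cases h : j = k
  · subst h
    rw [update_self]
    cases j <;> simp [set, get]
  · rw [update_of_ne h]
    cases k <;> cases j <;> first | rfl | exact absurd rfl h | skip
    rename_i a b
    exact update_of_ne (fun e => h (congrArg Stack.num e)) _ _

theorem set_get (s : Store) (k : Stack) : s.set k (s.get k) = s := by
  cases k <;> simp [set, get]

end Store

variable {α β : Type}

/-- A program of the machine. -/
abbrev Program (α : Type) := StackProgram Sym α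

/-- The program takes the stacks `s` to `s'` and returns `a`, in at most `n` instructions. -/
def RunsTo (M : Program α) (s : Store) (n : ℕ) (a : α) (s' : Store) : Prop :=
  M.Runs s.get n a s'.get

theorem RunsTo.mono {M : Program α} {s s' n m a} (h : RunsTo M s n a s') (hnm : n ≤ m) :
    RunsTo M s m a s' :=
  StackProgram.Runs.mono h hnm

theorem RunsTo.congr {M : Program α} {s s' s'' n m a a'} (h : RunsTo M s n a s') (hnm : n ≤ m)
    (ha : a = a') (hs : s' = s'') : RunsTo M s m a' s'' :=
  ha ▸ hs ▸ h.mono hnm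

theorem runsTo_ret (a : α) (s : Store) : RunsTo (.ret a) s 0 a s :=
  StackProgram.runs_ret _ _ _

theorem RunsTo.bind [Finite α] {p : Program α} {q : α → Program β} {s s' s'' n m a b}
    (hp : RunsTo p s n a s') (hq : RunsTo (q a) s' m b s'') :
    RunsTo (p.bind q) s (n + m) b s'' :=
  StackProgram.Runs.bind hp hq

theorem RunsTo.bind_ret [Finite α] {p : Program α} {f : α → β} {s s' n a}
    (hp : RunsTo p s n a s') : RunsTo (p.bind fun a => .ret (f a)) s n (f a) s' :=
  RunsTo.bind (q := fun a => .ret (f a)) hp (runsTo_ret (f a) s')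

theorem RunsTo.loop_exit [Finite β] {body : β → Program (β ⊕ α)} {b s s' n a}
    (h : RunsTo (body b) s n (Sum.inr a) s') : RunsTo (.loop body b) s (n + 1) a s' :=
  StackProgram.Runs.loop_exit h

theorem RunsTo.loop_next [Finite β] {body : β → Program (β ⊕ α)} {b b' s s' s'' n m a}
    (h : RunsTo (body b) s n (Sum.inl b') s') (h' : RunsTo (.loop body b') s' m a s'') :
    RunsTo (.loop body b) s (n + 1 + m) a s'' :=
  StackProgram.Runs.loop_next h h'

theorem runsTo_push (k : Stack) (x : Sym k) (s : Store) :
    RunsTo (.push k x) s 1 () (s.set k (x :: s.get k)) := by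
  unfold RunsTo
  rw [Store.get_set]
  exact StackProgram.runs_push k x _

theorem runsTo_pop_cons (k : Stack) {s : Store} {x l} (h : s.get k = x :: l) :
    RunsTo (.pop k) s 1 (some x) (s.set k l) := by
  have := StackProgram.runs_pop k s.get
  unfold RunsTo
  rw [Store.get_set]
  rwa [h] at this

theorem runsTo_pop_nil (k : Stack) {s : Store} (h : s.get k = []) :
    RunsTo (.pop k) s 1 none s := by
  have := StackProgram.runs_pop k s.get
  rw [← Store.get_set, h] at this
  have e : s.set k [] = s := by rw [← h, Store.set_get]
  rwa [List.tail_nil, e] at this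

theorem runsTo_move {j k : Stack} (hjk : j ≠ k) (f : Sym j → Sym k) (s : Store) :
    RunsTo (.move j k f) s (3 * (s.get j).length + 2) ()
      ((s.set j []).set k (((s.get j).map f).reverse ++ s.get k)) := by
  unfold RunsTo
  rw [Store.get_set, Store.get_set]
  exact StackProgram.runs_move hjk f _

theorem runsTo_drain (k : Stack) (s : Store) :
    RunsTo (.drain k) s (2 * (s.get k).length + 2) () (s.set k []) := by
  unfold RunsTo
  rw [Store.get_set]
  exact StackProgram.runs_drain k _

/-! ### Binary numbers -/

/-- The binary number, least significant digit first. -/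
def val : List Bool → ℕ
  | [] => 0
  | b :: l => b.toNat + 2 * val l

/-- Subtract one; there is no result for zero. -/
def decBits : List Bool → Option (List Bool)
  | [] => none
  | true :: l => some (false :: l)
  | false :: l => (decBits l).map (true :: ·)

/-- Subtract; there is no result if it is negative. -/
def subBits : List Bool → List Bool → Option (List Bool)
  | l, [] => some l
  | l, t :: ts => (if t then decBits l else some l).bind fun l' =>
      (subBits l'.tail ts).map (l'.headD false :: ·)

/-- Leading zeros are kept, so a counter never gets longer than the duration it was loaded with; the
time bounds depend on this. -/
theorem length_decBits {l l' : List Bool} (h : decBits l = some l') : l'.length = l.length := by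
  induction l generalizing l' with
  | nil => simp [decBits] at h
  | cons b l ih =>
    cases b
    · simp only [decBits, Option.map_eq_some_iff] at h
      obtain ⟨a, ha, rfl⟩ := h
      simp [ih ha]
    · simp only [decBits, Option.some.injEq] at h
      simp [← h]

theorem length_decBits_getD (l : List Bool) : ((decBits l).getD []).length ≤ l.length := by
  cases h : decBits l with
  | none => simp
  | some l' => simp [length_decBits h]

theorem length_subBits {l ts r : List Bool} (h : subBits l ts = some r) :
    r.length ≤ max l.length ts.length := by
  induction ts generalizing l r with
  | nil => simp only [subBits, Option.some.injEq] at h; simp [h]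
  | cons t ts ih =>
    simp only [subBits, Option.bind_eq_some_iff, Option.map_eq_some_iff] at h
    obtain ⟨l', hl', a, ha, rfl⟩ := h
    have h₁ : l'.length = l.length := by
      cases t
      · simp at hl'; rw [hl']
      · exact length_decBits (by simpa using hl')
    have := ih ha
    simp at this ⊢
    omega

theorem length_subBits_getD (l ts : List Bool) :
    ((subBits l ts).getD []).length ≤ max l.length ts.length := by
  cases h : subBits l ts with
  | none => simp
  | some l' => simpa using length_subBits h

theorem val_decBits (l : List Bool) :
    (decBits l = none ∧ val l = 0) ∨ ∃ l', decBits l = some l' ∧ val l' + 1 = val l := by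
  induction l with
  | nil => simp [decBits, val]
  | cons b l ih =>
    cases b
    · rcases ih with ⟨h, h'⟩ | ⟨l', h, h'⟩
      · exact .inl ⟨by simp [decBits, h], by simp [val, h']⟩
      · exact .inr ⟨true :: l', by simp [decBits, h], by simp [val]; omega⟩
    · exact .inr ⟨false :: l, rfl, by simp [val]; omega⟩

theorem val_decBits_getD (l : List Bool) : val ((decBits l).getD []) = val l - 1 := by
  rcases val_decBits l with ⟨h, h'⟩ | ⟨l', h, h'⟩
  · simp [h, h', val]
  · simp [h]; omega

theorem val_headD_tail (l : List Bool) : val l = (l.headD false).toNat + 2 * val l.tail := by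
  cases l <;> simp [val]

/-- Digit by digit: a digit 1 of the subtrahend is subtracted by decrementing all that is left of
the minuend, so no borrow has to be carried. A failing decrement means a negative difference. -/
theorem val_subBits (l ts : List Bool) :
    (subBits l ts = none ∧ val l < val ts) ∨
      ∃ r, subBits l ts = some r ∧ val r + val ts = val l := by
  induction ts generalizing l with
  | nil => exact .inr ⟨l, rfl, rfl⟩
  | cons t ts ih =>
    have key (l' : List Bool) : (subBits l (t :: ts) = (subBits l'.tail ts).map (l'.headD false :: ·)) →
        val l' + t.toNat = val l → (subBits l (t :: ts) = none ∧ val l < val (t :: ts)) ∨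
      ∃ r, subBits l (t :: ts) = some r ∧ val r + val (t :: ts) = val l := by
      intro h h'
      have hv := val_headD_tail l'
      have hb := Bool.toNat_lt (l'.headD false)
      rcases ih l'.tail with ⟨h₁, h₂⟩ | ⟨r, h₁, h₂⟩
      · refine .inl ⟨by rw [h, h₁]; rfl, ?_⟩
        simp only [val]
        omega
      · refine .inr ⟨_, by rw [h, h₁]; rfl, ?_⟩
        simp only [val]
        omega
    cases t
    · exact key l (by simp [subBits]) (by simp)
    · rcases val_decBits l with ⟨h, h'⟩ | ⟨l', h, h'⟩
      · exact .inl ⟨by simp [subBits, h], by simp [val, h']⟩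
      · exact key l' (by simp [subBits, h]) (by simpa using h')

theorem val_subBits_getD (l ts : List Bool) : val ((subBits l ts).getD []) = val l - val ts := by
  rcases val_subBits l ts with ⟨h, h'⟩ | ⟨l', h, h'⟩
  · simp [h, val]; omega
  · simp [h]; omega

theorem val_bits (n : ℕ) : val n.bits = n := by
  induction n using Nat.binaryRec' with
  | zero => simp [val]
  | bit b n h ih => rw [Nat.bits_append_bit _ _ h, val, ih, Nat.bit_val]; ring

/-- Subtract one from the counter and tell whether it was positive; zero is stored without
digits. -/
def decRem : Program Bool :=
  .loop (β := Unit) (fun _ => (StackProgram.pop (Γ := Sym) .rem).bind fun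
    | none => (StackProgram.drain .tmp).bind fun _ => .ret (Sum.inr false)
    | some false => (StackProgram.push .tmp true).bind fun _ => .ret (Sum.inl ())
    | some true => (StackProgram.push .rem false).bind fun _ =>
        (StackProgram.move .tmp .rem id).bind fun _ => .ret (Sum.inr true)) ()

/-- The stack `tmp` holds, already flipped to ones, the zeros passed so far. Each digit costs three
instructions on the way down and at most three on the way back, hence 6 for digits still in `rem`
and 3 for those already in `tmp`. -/
theorem runsTo_decRem_aux (s : Store) :
    RunsTo decRem s (6 * s.rem.length + 3 * s.tmp.length + 8) (decBits s.rem).isSome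
      { s with rem := ((decBits s.rem).map (s.tmp.reverse ++ ·)).getD [], tmp := [] } := by
  generalize h : s.rem = l
  induction l generalizing s with
  | nil =>
    refine RunsTo.congr (RunsTo.loop_exit (RunsTo.bind (runsTo_pop_nil .rem h)
      (RunsTo.bind_ret (runsTo_drain _ _)))) ?_ rfl ?_
    · simp [Store.get]; omega
    · simp [Store.set, decBits, h]
  | cons b l ih =>
    cases b
    · refine RunsTo.congr (RunsTo.loop_next (RunsTo.bind (runsTo_pop_cons .rem h)
        (RunsTo.bind_ret (runsTo_push _ _ _))) (ih _ rfl)) ?_ ?_ ?_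
      · simp [Store.get, Store.set]; omega
      · simp [decBits]
      · simp [Store.set, Store.get, decBits, Function.comp_def]
    · refine RunsTo.congr (RunsTo.loop_exit (RunsTo.bind (runsTo_pop_cons .rem h)
        (RunsTo.bind (runsTo_push _ _ _) (RunsTo.bind_ret (runsTo_move (by decide) _ _))))) ?_ rfl ?_
      · simp [Store.get, Store.set]; omega
      · simp [Store.set, Store.get, decBits]

theorem runsTo_decRem {s : Store} (h : s.tmp = []) :
    RunsTo decRem s (6 * s.rem.length + 8) (decBits s.rem).isSome
      { s with rem := (decBits s.rem).getD [] } :=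
  (runsTo_decRem_aux s).congr (by simp [h]) rfl (by simp [h])

/-- Copy the minimum duration of status `b` to the counter. -/
def copyNum (b : Bool) : Program Unit :=
  (StackProgram.move (.num (some b)) .tmp id).bind fun _ =>
    .loop (β := Unit) (fun _ => (StackProgram.pop (Γ := Sym) .tmp).bind fun
      | none => .ret (Sum.inr ())
      | some x => (StackProgram.push (.num (some b)) x).bind fun _ =>
          (StackProgram.push .rem x).bind fun _ => .ret (Sum.inl ())) ()

theorem runsTo_copyNum_loop (b : Bool) (s : Store) :
    RunsTo (.loop (β := Unit) (fun _ => (StackProgram.pop (Γ := Sym) .tmp).bind fun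
      | none => .ret (Sum.inr ())
      | some x => (StackProgram.push (.num (some b)) x).bind fun _ =>
          (StackProgram.push .rem x).bind fun _ => .ret (Sum.inl ())) ())
      s (4 * s.tmp.length + 2) ()
      { s with
        num := update s.num (some b) (s.tmp.reverse ++ s.num (some b))
        rem := s.tmp.reverse ++ s.rem
        tmp := [] } := by
  generalize h : s.tmp = l
  induction l generalizing s with
  | nil =>
    refine RunsTo.congr (RunsTo.loop_exit (RunsTo.bind (runsTo_pop_nil .tmp h)
      (runsTo_ret _ _))) ?_ rfl ?_
    · simp
    · simp only [List.reverse_nil, List.nil_append, update_eq_self]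
      rw [← h]
  | cons x l ih =>
    refine RunsTo.congr (RunsTo.loop_next (RunsTo.bind (runsTo_pop_cons .tmp h)
        (RunsTo.bind (runsTo_push _ _ _) (RunsTo.bind_ret (runsTo_push _ _ _)))) (ih _ rfl)) ?_ rfl ?_
    · simp; omega
    · simp [Store.set, Store.get]

theorem runsTo_copyNum (b : Bool) {s : Store} (h : s.tmp = []) (h' : s.rem = []) :
    RunsTo (copyNum b) s (7 * (s.num (some b)).length + 4) ()
      { s with rem := s.num (some b) } := by
  refine RunsTo.congr (RunsTo.bind (runsTo_move (by simp) _ _) (runsTo_copyNum_loop b _)) ?_ rfl ?_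
  · simp [Store.set, Store.get, h]; omega
  · simp [Store.set, Store.get, h, h']

/-- Set the counter to the number of further periods for which status `b` is forced after a
change to it. -/
def refill (b : Bool) : Program Unit :=
  (copyNum b).bind fun _ => decRem.bind fun _ => .ret ()

/-- The decrement accounts for the period of the change itself. A duration zero leaves the counter
empty, exactly as a duration one leaves it at zero. -/
theorem runsTo_refill (b : Bool) {s : Store} (h : s.tmp = []) (h' : s.rem = []) :
    RunsTo (refill b) s (13 * (s.num (some b)).length + 12) ()
      { s with rem := (decBits (s.num (some b))).getD [] } := by
  refine RunsTo.congr (RunsTo.bind (runsTo_copyNum b h h') (RunsTo.bind_ret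
    (runsTo_decRem (s := { s with rem := s.num (some b) }) h))) ?_ rfl rfl
  simp; omega

/-- Subtract the initial time from the counter. -/
def subtract : Program Unit :=
  .loop (fun neg => (StackProgram.pop (Γ := Sym) (.num none)).bind fun
    | none => (if neg then StackProgram.drain .digits else .move .digits .rem id).bind fun _ =>
        .ret (Sum.inr ())
    | some t => (if t && !neg then decRem else .ret true).bind fun ok =>
        (StackProgram.pop (Γ := Sym) .rem).bind fun o =>
          (StackProgram.push .digits (o.getD false)).bind fun _ =>
            .ret (Sum.inl (neg || !ok))) false

theorem runsTo_subtract {s : Store} {B : ℕ} (h : s.tmp = []) (h' : s.digits = [])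
    (hB : s.rem.length ≤ B) :
    RunsTo subtract s ((s.num none).length * (6 * B + 15) + 4) ()
      { s with num := update s.num none [], rem := (subBits s.rem (s.num none)).getD [] } := by
  have pop_rem (s : Store) :
      RunsTo (.pop .rem) s 1 s.rem.head? { s with rem := s.rem.tail } := by
    cases h : s.rem with
    | nil => exact (runsTo_pop_nil .rem h).congr le_rfl rfl (by rw [List.tail_nil, ← h])
    | cons x l => exact runsTo_pop_cons .rem h
  -- The loop with `digits` arbitrary: they are the low digits of the difference, in reverse. Once
  -- `neg` holds, `rem` is empty and the digits are discarded at the end. Each subtrahend digit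
  -- costs at most one decrement, `6 * B + 8`, four further instructions, and three to move its
  -- result digit back.
  have aux (ts : List Bool) : ∀ (neg : Bool) (s : Store), s.num none = ts → s.tmp = [] →
      s.rem.length ≤ B → (neg = true → s.rem = []) →
      RunsTo (.loop (fun neg => (StackProgram.pop (Γ := Sym) (.num none)).bind fun
    | none => (if neg then StackProgram.drain .digits else .move .digits .rem id).bind fun _ =>
        .ret (Sum.inr ())
    | some t => (if t && !neg then decRem else .ret true).bind fun ok =>
        (StackProgram.pop (Γ := Sym) .rem).bind fun o =>
          (StackProgram.push .digits (o.getD false)).bind fun _ =>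
            .ret (Sum.inl (neg || !ok))) neg) s
        (ts.length * (6 * B + 15) + 3 * s.digits.length + 4) ()
        { s with
          num := update s.num none []
          digits := []
          rem := if neg then [] else
            ((subBits s.rem ts).map (s.digits.reverse ++ ·)).getD [] } := by
    induction ts with
    | nil =>
      intro neg s hn ht hr hneg
      cases neg
      · refine RunsTo.congr (RunsTo.loop_exit (RunsTo.bind (runsTo_pop_nil (.num none) hn)
          (RunsTo.bind_ret (runsTo_move (by decide) _ _)))) ?_ rfl ?_
        · simp [Store.get]; omega
        · simp [Store.set, Store.get, subBits, ← hn]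
      · refine RunsTo.congr (RunsTo.loop_exit (RunsTo.bind (runsTo_pop_nil (.num none) hn)
          (RunsTo.bind_ret (runsTo_drain _ _)))) ?_ rfl ?_
        · simp [Store.get]; omega
        · simp [Store.set, ← hn, hneg]
    | cons t ts ih =>
      intro neg s hn ht hr hneg
      have hpop := runsTo_pop_cons (.num none) hn
      by_cases hc : t = true ∧ neg = false
      · obtain ⟨rfl, rfl⟩ := hc
        have hd := runsTo_decRem (s := s.set (.num none) ts) ht
        have hl := length_decBits_getD s.rem
        refine RunsTo.congr (RunsTo.loop_next (RunsTo.bind hpop (RunsTo.bind hd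
          (RunsTo.bind (pop_rem _) (RunsTo.bind_ret (runsTo_push _ _ _)))))
          (ih _ _ ?_ ht ?_ ?_)) ?_ rfl ?_
        · simp [Store.set]
        · simp [Store.set]; omega
        · simp [Store.set]
          intro h
          simp [h]
        · simp [Store.set, Store.get]
          ring_nf
          omega
        · cases hdec : decBits s.rem with
          | none => simp [Store.set, Store.get, subBits, hdec]
          | some r =>
            cases r <;> simp [Store.set, Store.get, subBits, hdec, Function.comp_def]
      · have hc' : (t && !neg) = false := by
          cases t <;> cases neg <;> simp_all
        refine RunsTo.congr (RunsTo.loop_next (RunsTo.bind hpop (RunsTo.bind (a := true)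
          (s' := s.set (.num none) ts) (n := 0) ?_
          (RunsTo.bind (pop_rem _) (RunsTo.bind_ret (runsTo_push _ _ _)))))
          (ih _ _ ?_ ht ?_ ?_)) ?_ rfl ?_
        · simp only [hc']
          exact runsTo_ret _ _
        · simp [Store.set]
        · simp [Store.set]; omega
        · simp [Store.set]
          intro h
          simp [hneg h]
        · simp [Store.set, Store.get]
          ring_nf
          omega
        · cases neg
          · have : t = false := by simpa using hc
            subst this
            cases hr : s.rem <;>
              simp [Store.set, Store.get, subBits, Function.comp_def, hr]
          · simp [Store.set, Store.get]
  refine (aux _ false s rfl h hB (by simp)).congr ?_ rfl ?_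
  · simp [h']
  · simp [h']

/-! ### Following a policy -/

/-- The periods visited when the policy is followed from status `b` with counter `r`; `N` gives the
minimum durations. -/
def follow (N : Bool → List Bool) : Bool → List Bool → List PlanItem → List Visit
  | _, _, [] => []
  | b, r, i :: l => match decBits r with
    | some r' => (i, b, b) :: follow N b r' l
    | none => if i.2 b then (i, b, !b) :: follow N (!b) ((decBits (N !b)).getD []) l
        else (i, b, b) :: follow N b [] l

/-- A simulation consumes the plan, but the trail remembers it; `tally` can therefore restore it. -/
theorem map_fst_follow (N : Bool → List Bool) (b : Bool) (r : List Bool) (l : List PlanItem) :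
    (follow N b r l).map Prod.fst = l := by
  induction l generalizing b r with
  | nil => rfl
  | cons i l ih =>
    simp only [follow]
    split
    · simp [ih]
    · split <;> simp [ih]

/-- Follow the policy of the plan, which moves the visited periods to the trail. -/
def simulate (b : Bool) : Program Unit :=
  .loop (fun b => (StackProgram.pop (Γ := Sym) .plan).bind fun
    | none => (StackProgram.drain .rem).bind fun _ => .ret (Sum.inr ())
    | some i => decRem.bind fun ok =>
        if ok then (StackProgram.push .trail (i, b, b)).bind fun _ => .ret (Sum.inl b)
        else if i.2 b then (refill (!b)).bind fun _ =>
          (StackProgram.push .trail (i, b, !b)).bind fun _ => .ret (Sum.inl (!b))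
        else (StackProgram.push .trail (i, b, b)).bind fun _ => .ret (Sum.inl b)) b

/-- The most expensive period is one with a change: a decrement `6 * B + 8`, a refill `13 * B + 12`
and a few single instructions. The counter keeps at most `B` digits throughout. -/
theorem runsTo_simulate (b : Bool) {s : Store} {B : ℕ} (h : s.tmp = [])
    (hr : s.rem.length ≤ B) (hB : ∀ b, (s.num (some b)).length ≤ B) :
    RunsTo (simulate b) s (s.plan.length * (19 * B + 25) + 2 * B + 4) ()
      { s with
        plan := []
        rem := []
        trail := (follow (fun b => s.num (some b)) b s.rem s.plan).reverse ++ s.trail } := by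
  unfold simulate
  generalize hp : s.plan = l
  induction l generalizing s b with
  | nil =>
    refine RunsTo.congr (RunsTo.loop_exit (RunsTo.bind (runsTo_pop_nil .plan hp)
      (RunsTo.bind_ret (runsTo_drain _ _)))) ?_ rfl ?_
    · simp [Store.get]; omega
    · simp [Store.set, follow, hp]
  | cons i l ih =>
    have hpop := runsTo_pop_cons .plan hp
    have hd := runsTo_decRem (s := s.set .plan l) h
    have hl := length_decBits_getD s.rem
    change RunsTo decRem _ _ (decBits s.rem).isSome _ at hd
    cases hdec : decBits s.rem with
    | some r =>
      rw [hdec] at hd hl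
      refine RunsTo.congr (RunsTo.loop_next (RunsTo.bind hpop (RunsTo.bind hd
          (RunsTo.bind_ret (runsTo_push .trail (i, b, b) _))))
          (ih b ?_ ?_ ?_ rfl)) ?_ rfl ?_
      · simp [Store.set, h]
      · simpa [Store.set, hdec] using hl.trans hr
      · simpa [Store.set] using hB
      · simp [Store.set]
        ring_nf
        omega
      · simp [Store.set, Store.get, follow, hdec]
    | none =>
      have hd : RunsTo decRem (s.set .plan l) (6 * s.rem.length + 8) false
          { s with plan := l, rem := [] } :=
        hd.congr le_rfl (by simp [hdec]) (by simp [Store.set, hdec])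
      by_cases hi : i.2 b = true
      · have hf := runsTo_refill (!b) (s := { s with plan := l, rem := [] }) h rfl
        have hlf := length_decBits_getD (s.num (some !b))
        have hn := hB (!b)
        refine RunsTo.congr (RunsTo.loop_next (b' := !b) (RunsTo.bind hpop (RunsTo.bind hd
          (m := 13 * B + 12 + 1) ?_)) (ih (!b) (s := { s with
            plan := l, rem := (decBits (s.num (some !b))).getD [], trail := (i, b, !b) :: s.trail })
            h ?_ ?_ rfl)) ?_ rfl ?_
        · simp only [hi]
          refine RunsTo.congr (RunsTo.bind hf (RunsTo.bind_ret
            (runsTo_push .trail (i, b, !b) _))) ?_ rfl ?_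
          · simp; omega
          · simp [Store.set, Store.get]
        · simp; omega
        · simpa [Store.set] using hB
        · simp
          ring_nf
          omega
        · simp [follow, hdec, hi]
      · refine RunsTo.congr (RunsTo.loop_next (b' := b) (RunsTo.bind hpop (RunsTo.bind hd
          (m := 1) ?_)) (ih b (s := { s with
            plan := l, rem := [], trail := (i, b, b) :: s.trail })
            h ?_ ?_ rfl)) ?_ rfl ?_
        · simp only [hi]
          exact RunsTo.congr (RunsTo.bind_ret (runsTo_push .trail (i, b, b) _)) le_rfl rfl
            (by simp [Store.set, Store.get])
        · simp
        · simpa [Store.set] using hB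
        · simp
          ring_nf
          omega
        · simp [follow, hdec, hi]

/-- The visit violates the must-run flag. -/
def Visit.bad (v : Visit) : Bool := v.1.1.1 && !v.2.2

/-- The visit differs from the prediction. -/
def Visit.miss (v : Visit) : Bool := v.2.2 != v.1.1.2

/-- Move the trail back to the plan, and count the differences from the prediction up or down.
The result tells whether a must-run flag is violated and whether the count would fall below zero. -/
def tally (down : Bool) : Program (Bool × Bool) :=
  .loop (fun r => (StackProgram.pop (Γ := Sym) .trail).bind fun
    | none => .ret (Sum.inr r)
    | some v => (StackProgram.push .plan v.1).bind fun _ =>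
        if v.miss then
          if down then (StackProgram.pop (Γ := Sym) .cnt).bind fun o =>
            .ret (Sum.inl (v.bad || r.1, o.isNone || r.2))
          else (StackProgram.push .cnt ()).bind fun _ => .ret (Sum.inl (v.bad || r.1, r.2))
        else .ret (Sum.inl (v.bad || r.1, r.2))) (false, false)

theorem runsTo_tally_up (s : Store) {c : ℕ} (hc : s.cnt = List.replicate c ()) :
    RunsTo (tally false) s (s.trail.length * 4 + 2) (s.trail.any Visit.bad, false)
      { s with
        trail := []
        plan := (s.trail.map Prod.fst).reverse ++ s.plan
        cnt := List.replicate (c + s.trail.countP Visit.miss) () } := by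
  unfold tally
  -- The flag accumulated in the loop state has to be arbitrary for the induction.
  suffices H : ∀ (t : List Visit) (s : Store) (c : ℕ) (x : Bool), s.trail = t →
      s.cnt = List.replicate c () →
      RunsTo (.loop (fun r => (StackProgram.pop (Γ := Sym) .trail).bind fun
        | none => .ret (Sum.inr r)
        | some v => (StackProgram.push .plan v.1).bind fun _ =>
          if v.miss then
            if false then (StackProgram.pop (Γ := Sym) .cnt).bind fun o =>
              .ret (Sum.inl (v.bad || r.1, o.isNone || r.2))
            else (StackProgram.push .cnt ()).bind fun _ => .ret (Sum.inl (v.bad || r.1, r.2))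
          else .ret (Sum.inl (v.bad || r.1, r.2))) (x, false)) s (t.length * 4 + 2)
          (t.any Visit.bad || x, false)
        { s with
          trail := []
          plan := (t.map Prod.fst).reverse ++ s.plan
          cnt := List.replicate (c + t.countP Visit.miss) () } from
    (H _ s c false rfl hc).congr le_rfl (by simp) rfl
  intro t
  induction t with
  | nil =>
    intro s c x ht hc
    refine RunsTo.congr (RunsTo.loop_exit (RunsTo.bind (runsTo_pop_nil .trail ht)
      (runsTo_ret _ _))) ?_ ?_ ?_
    · simp
    · simp
    · simp only [List.map_nil, List.reverse_nil, List.nil_append, List.countP_nil, Nat.add_zero]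
      rw [← hc, ← ht]
  | cons v t ih =>
    intro s c x ht hc
    have hpop := runsTo_pop_cons .trail ht
    by_cases hm : v.miss = true
    · refine RunsTo.congr (RunsTo.loop_next (b' := (v.bad || x, false)) (RunsTo.bind hpop
        (RunsTo.bind (runsTo_push .plan v.1 _) (m := 1)
          (s'' := { s with trail := t, plan := v.1 :: s.plan, cnt := () :: s.cnt }) ?_))
        (ih _ (c + 1) _ rfl (by simp [hc, List.replicate_succ]))) ?_ ?_ ?_
      · simp only [hm]
        exact RunsTo.bind_ret (runsTo_push .cnt () _)
      · simp; omega
      · simp [← Bool.or_assoc, Bool.or_comm]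
      · simp [hm, add_assoc, add_comm]
    · refine RunsTo.congr (RunsTo.loop_next (b' := (v.bad || x, false)) (RunsTo.bind hpop
        (RunsTo.bind (runsTo_push .plan v.1 _) (m := 0)
          (s'' := { s with trail := t, plan := v.1 :: s.plan }) ?_))
        (ih _ c _ rfl hc)) ?_ ?_ ?_
      · simp only [hm]
        exact runsTo_ret _ _
      · simp; omega
      · simp [← Bool.or_assoc, Bool.or_comm]
      · simp [hm]

/-- A pop from the empty unary counter reveals that there are more differences than were counted up
before, which compares the two alternatives. -/
theorem runsTo_tally_down (s : Store) {c : ℕ} (hc : s.cnt = List.replicate c ()) :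
    RunsTo (tally true) s (s.trail.length * 4 + 2)
      (s.trail.any Visit.bad, decide (c < s.trail.countP Visit.miss))
      { s with
        trail := []
        plan := (s.trail.map Prod.fst).reverse ++ s.plan
        cnt := List.replicate (c - s.trail.countP Visit.miss) () } := by
  unfold tally
  suffices H : ∀ (t : List Visit) (s : Store) (c : ℕ) (x y : Bool), s.trail = t →
      s.cnt = List.replicate c () →
      RunsTo (.loop (fun r => (StackProgram.pop (Γ := Sym) .trail).bind fun
        | none => .ret (Sum.inr r)
        | some v => (StackProgram.push .plan v.1).bind fun _ =>
          if v.miss then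
            if true then (StackProgram.pop (Γ := Sym) .cnt).bind fun o =>
              .ret (Sum.inl (v.bad || r.1, o.isNone || r.2))
            else (StackProgram.push .cnt ()).bind fun _ => .ret (Sum.inl (v.bad || r.1, r.2))
          else .ret (Sum.inl (v.bad || r.1, r.2))) (x, y)) s (t.length * 4 + 2)
          (t.any Visit.bad || x, decide (c < t.countP Visit.miss) || y)
        { s with
          trail := []
          plan := (t.map Prod.fst).reverse ++ s.plan
          cnt := List.replicate (c - t.countP Visit.miss) () } from
    (H _ s c false false rfl hc).congr le_rfl (by simp) rfl
  intro t
  induction t with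
  | nil =>
    intro s c x y ht hc
    refine RunsTo.congr (RunsTo.loop_exit (RunsTo.bind (runsTo_pop_nil .trail ht)
      (runsTo_ret _ _))) ?_ ?_ ?_
    · simp
    · simp
    · simp only [List.map_nil, List.reverse_nil, List.nil_append, List.countP_nil, Nat.sub_zero]
      rw [← hc, ← ht]
  | cons v t ih =>
    intro s c x y ht hc
    have hpop := runsTo_pop_cons .trail ht
    by_cases hm : v.miss = true
    · refine RunsTo.congr (RunsTo.loop_next (b' := (v.bad || x, decide (c = 0) || y))
        (RunsTo.bind hpop (RunsTo.bind (runsTo_push .plan v.1 _) (m := 1)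
          (s'' := { s with
            trail := t, plan := v.1 :: s.plan, cnt := List.replicate (c - 1) () }) ?_))
        (ih _ (c - 1) _ _ rfl rfl)) ?_ ?_ ?_
      · simp only [hm]
        cases c with
        | zero =>
          exact RunsTo.congr (RunsTo.bind_ret (runsTo_pop_nil .cnt hc)) le_rfl (by simp)
            (by rw [← hc]; rfl)
        | succ c =>
          exact RunsTo.congr (RunsTo.bind_ret (runsTo_pop_cons .cnt hc)) le_rfl (by simp)
            (by simp [Store.set, Store.get])
      · simp; omega
      -- The count falls below zero at this visit if `c = 0`, or at a later one if the remaining `c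
      -- - 1` does not suffice.
      · have : (decide (c - 1 < t.countP Visit.miss) || decide (c = 0)) =
            decide (c < t.countP Visit.miss + 1) := by
          rw [← Bool.decide_or]
          exact decide_eq_decide.2 (by omega)
        refine Prod.ext ?_ ?_
        · simp [← Bool.or_assoc, Bool.or_comm]
        · simp only [List.countP_cons_of_pos hm, ← this, Bool.or_assoc]
      · simp [hm, Nat.sub_sub, add_comm]
    · refine RunsTo.congr (RunsTo.loop_next (b' := (v.bad || x, y)) (RunsTo.bind hpop
        (RunsTo.bind (runsTo_push .plan v.1 _) (m := 0)
          (s'' := { s with trail := t, plan := v.1 :: s.plan }) ?_))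
        (ih _ c _ _ rfl hc)) ?_ ?_ ?_
      · simp only [hm]
        exact runsTo_ret _ _
      · simp; omega
      · simp [hm, ← Bool.or_assoc, Bool.or_comm]
      · simp [hm]

/-! ### Planning -/

/-- Follow the plan preceded by a period with decision `d`, and evaluate the outcome. -/
def trial (p : Bool × Bool) (b d down : Bool) : Program (Bool × Bool) :=
  (StackProgram.push .plan (p, fun _ => d)).bind fun _ => (simulate b).bind fun _ =>
    (tally down).bind fun r => (StackProgram.pop (Γ := Sym) .plan).bind fun _ => .ret r

/-- Whether to change status `b` in a period that precedes the plan. -/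
def choose (p : Bool × Bool) (b : Bool) : Program Bool :=
  (trial p b false false).bind fun r => (trial p b true true).bind fun r' =>
    (StackProgram.drain .cnt).bind fun _ => .ret (!r'.1 && (r.1 || !r'.2))

/-- The decision made by `choose`. -/
def decision (N : Bool → List Bool) (plan : List PlanItem) (p : Bool × Bool) (b : Bool) : Bool :=
  let stay := follow N b [] ((p, fun _ => false) :: plan)
  let change := follow N b [] ((p, fun _ => true) :: plan)
  !change.any Visit.bad && (stay.any Visit.bad ||
    !decide (stay.countP Visit.miss < change.countP Visit.miss))

/-- A policy for the periods `l`, planned from the last one on. -/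
def makePlan (N : Bool → List Bool) (l : List (Bool × Bool)) : List PlanItem :=
  l.foldr (fun p plan => (p, decision N plan p) :: plan) []

theorem length_follow (N : Bool → List Bool) (b : Bool) (r : List Bool) (l : List PlanItem) :
    (follow N b r l).length = l.length := by
  rw [← List.length_map (f := Prod.fst), map_fst_follow]

theorem length_makePlan (N : Bool → List Bool) (l : List (Bool × Bool)) :
    (makePlan N l).length = l.length := by
  induction l with
  | nil => rfl
  | cons p l ih => simpa [makePlan] using ih

/-- The outcome of `tally` is a hypothesis so that counting up and counting down are covered
together. The counter starts empty, so the status is free and the added period obeys `d`. -/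
theorem runsTo_trial (p : Bool × Bool) (b d down : Bool) {s : Store} {B : ℕ} (ht : s.tmp = [])
    (hr : s.rem = []) (htr : s.trail = []) (hB : ∀ b, (s.num (some b)).length ≤ B)
    {r : Bool × Bool} {c : List Unit}
    (h : RunsTo (tally down)
      { s with
        plan := []
        trail := (follow (fun b => s.num (some b)) b [] ((p, fun _ => d) :: s.plan)).reverse }
      ((s.plan.length + 1) * 4 + 2) r { s with plan := (p, fun _ => d) :: s.plan, cnt := c }) :
    RunsTo (trial p b d down) s ((s.plan.length + 1) * (21 * B + 40)) r { s with cnt := c } := by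
  have h₂ := (runsTo_simulate b (s := { s with plan := (p, fun _ => d) :: s.plan }) (B := B)
    ht (by simp [hr]) hB).congr le_rfl rfl (s'' := { s with
        plan := []
        trail := (follow (fun b => s.num (some b)) b [] ((p, fun _ => d) :: s.plan)).reverse })
    (by simp [htr, hr])
  refine RunsTo.congr (RunsTo.bind (runsTo_push .plan (p, fun _ => d) s) (RunsTo.bind h₂
    (RunsTo.bind h (RunsTo.bind_ret (f := fun _ => r) (runsTo_pop_cons .plan
      (s := { s with plan := (p, fun _ => d) :: s.plan, cnt := c }) rfl))))) ?_ rfl rfl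
  simp
  ring_nf
  omega

/-- Staying is counted up and changing counted down, so the second flag says that changing differs
strictly more often; a tie goes to changing. Two trials cost `42 * B + 80` per period, and draining
the counter takes the remaining 4. -/
theorem runsTo_choose (p : Bool × Bool) (b : Bool) {s : Store} {B : ℕ} (ht : s.tmp = [])
    (hr : s.rem = []) (htr : s.trail = []) (hc : s.cnt = [])
    (hB : ∀ b, (s.num (some b)).length ≤ B) :
    RunsTo (choose p b) s ((s.plan.length + 1) * (42 * B + 84))
      (decision (fun b => s.num (some b)) s.plan p b) s := by
  set N := fun b => s.num (some b) with hN
  set stay := follow N b [] ((p, fun _ => false) :: s.plan) with hstay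
  set change := follow N b [] ((p, fun _ => true) :: s.plan) with hchange
  have hl : stay.length = s.plan.length + 1 := by simp [hstay, length_follow]
  have hl' : change.length = s.plan.length + 1 := by simp [hchange, length_follow]
  have hm : stay.countP Visit.miss ≤ s.plan.length + 1 := hl ▸ List.countP_le_length
  have h₁ := runsTo_trial p b false false ht hr htr hB
    ((runsTo_tally_up { s with plan := [], trail := stay.reverse } (c := 0) hc).congr
      (by simp [hl]) rfl (by simp [hstay, map_fst_follow, htr]; rfl))
  have h₂ := runsTo_trial p b true true (s := { s with
      cnt := List.replicate (0 + stay.countP Visit.miss) () }) ht hr htr hB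
    ((runsTo_tally_down { s with
        plan := []
        trail := change.reverse
        cnt := List.replicate (0 + stay.countP Visit.miss) () } rfl).congr
      (by simp [hl']) rfl (by simp [hchange, map_fst_follow, htr]; rfl))
  simp only [List.any_reverse, List.countP_reverse, zero_add] at h₁ h₂
  refine RunsTo.congr (RunsTo.bind h₁ (RunsTo.bind h₂ (RunsTo.bind_ret
    (runsTo_drain _ _)))) ?_ ?_ ?_
  · simp [Store.get]
    ring_nf
    omega
  · simp [decision, hstay, hchange]
  · simp [Store.set, ← hc]

/-- Plan all periods. -/
def planAll : Program Unit :=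
  .loop (β := Unit) (fun _ => (StackProgram.pop (Γ := Sym) .todo).bind fun
    | none => .ret (Sum.inr ())
    | some p => (choose p true).bind fun d => (choose p false).bind fun d' =>
        (StackProgram.push .plan (p, fun b => if b then d else d')).bind fun _ =>
          .ret (Sum.inl ())) ()

/-- Loop invariant: the periods `l` are still to be planned, with the last one on top, and the later
periods `l'` are planned. Two choices per period, one for each status, give `84 * B + 168`. -/
theorem runsTo_planAll {s : Store} {B T : ℕ} (ht : s.tmp = [])
    (hr : s.rem = []) (htr : s.trail = []) (hc : s.cnt = [])
    (hB : ∀ b, (s.num (some b)).length ≤ B) {l l' : List (Bool × Bool)} (hl : s.todo = l.reverse)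
    (hl' : s.plan = makePlan (fun b => s.num (some b)) l') (hT : l.length + l'.length ≤ T) :
    RunsTo planAll s (l.length * (T * (84 * B + 168) + 3) + 2) ()
      { s with todo := [], plan := makePlan (fun b => s.num (some b)) (l ++ l') } := by
  induction l using List.reverseRecOn generalizing s l' with
  | nil =>
    exact RunsTo.congr (RunsTo.loop_exit (RunsTo.bind (runsTo_pop_nil .todo hl)
      (runsTo_ret _ _))) (by simp) rfl (by
        rw [List.nil_append, ← hl', ← (show s.todo = [] from hl)])
  | append_singleton l p ih =>
    have h₁ := runsTo_choose p true (s := { s with todo := l.reverse }) ht hr htr hc hB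
    have h₂ := runsTo_choose p false (s := { s with todo := l.reverse }) ht hr htr hc hB
    have hp : s.plan.length = l'.length := by rw [hl', length_makePlan]
    have h₃ := ih (s := { s with
        todo := l.reverse
        plan := makePlan (fun b => s.num (some b)) (p :: l') }) (l' := p :: l')
      ht hr htr hc hB rfl rfl (by simp at hT ⊢; omega)
    refine RunsTo.congr (RunsTo.loop_next (RunsTo.bind (runsTo_pop_cons .todo
      (hl.trans (List.reverse_append ..))) (RunsTo.bind h₁ (RunsTo.bind h₂
        (RunsTo.bind_ret ((runsTo_push _ _ _).congr le_rfl rfl ?_))))) h₃) ?_ rfl ?_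
    · simp only [Store.set, Store.get, Store.mk.injEq, true_and, and_true]
      rw [makePlan, List.foldr_cons, ← makePlan, ← hl']
      congr 2
      funext b
      cases b <;> rfl
    · simp only [hp]
      simp only [List.length_append, List.length_singleton] at hT ⊢
      have : (l'.length + 1) * (42 * B + 84) ≤ T * (42 * B + 84) :=
        Nat.mul_le_mul_right _ (by omega)
      have e : T * (84 * B + 168) = 2 * (T * (42 * B + 84)) := by ring
      rw [e, add_mul l.length 1]
      omega
    · simp

/-! ### Reading the input -/

/-- Read a number. -/
def readNum (j : Option Bool) : Program Unit :=
  (StackProgram.loop (β := Unit) (fun _ => (StackProgram.pop (Γ := Sym) .inp).bind fun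
    | some (.bit x) => (StackProgram.push .tmp x).bind fun _ => .ret (Sum.inl ())
    | _ => .ret (Sum.inr ())) ()).bind fun _ => .move .tmp (.num j) id

theorem runsTo_readNum (j : Option Bool) {s : Store} {n : ℕ} {rest : List InSymbol}
    (h : s.inp = encodeNumber n ++ rest) (ht : s.tmp = []) (hj : s.num j = []) :
    RunsTo (readNum j) s (6 * n.bits.length + 4) ()
      { s with inp := rest, num := update s.num j n.bits } := by
  have aux (l : List Bool) : ∀ s : Store, s.inp = l.map InSymbol.bit ++ .endMark :: rest →
      RunsTo (StackProgram.loop (β := Unit) (fun _ => (StackProgram.pop (Γ := Sym) .inp).bind fun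
        | some (.bit x) => (StackProgram.push .tmp x).bind fun _ => .ret (Sum.inl ())
        | _ => .ret (Sum.inr ())) ()) s (3 * l.length + 2) ()
        { s with inp := rest, tmp := l.reverse ++ s.tmp } := by
    induction l with
    | nil =>
      intro s h
      exact RunsTo.congr (RunsTo.loop_exit (RunsTo.bind (runsTo_pop_cons .inp h)
        (runsTo_ret _ _))) (by simp) rfl (by simp [Store.set])
    | cons x l ih =>
      intro s h
      exact RunsTo.congr (RunsTo.loop_next (RunsTo.bind (runsTo_pop_cons .inp h)
        (RunsTo.bind_ret (runsTo_push .tmp x _))) (ih _ rfl)) (by simp; omega) rfl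
        (by simp [Store.set, Store.get])
  refine RunsTo.congr (RunsTo.bind (aux n.bits s (by simp [h, encodeNumber]))
    (runsTo_move (by simp) _ _)) ?_ rfl ?_
  · simp [Store.get, ht]; omega
  · simp [Store.set, Store.get, ht, hj]

/-- Read the periods of a generator. -/
def readPeriods : Program Unit :=
  .loop (β := Unit) (fun _ => (StackProgram.pop (Γ := Sym) .inp).bind fun
    | some (.period m p) => (StackProgram.push .todo (m, p)).bind fun _ => .ret (Sum.inl ())
    | _ => .ret (Sum.inr ())) ()

theorem runsTo_readPeriods {s : Store} {l : List (Bool × Bool)} {rest : List InSymbol}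
    (h : s.inp = l.map (fun p => InSymbol.period p.1 p.2) ++ .endMark :: rest) :
    RunsTo readPeriods s (3 * l.length + 2) ()
      { s with inp := rest, todo := l.reverse ++ s.todo } := by
  induction l generalizing s with
  | nil =>
    exact RunsTo.congr (RunsTo.loop_exit (RunsTo.bind (runsTo_pop_cons .inp h)
      (runsTo_ret _ _))) (by simp) rfl (by simp [Store.set])
  | cons x l ih =>
    exact RunsTo.congr (RunsTo.loop_next (RunsTo.bind (runsTo_pop_cons .inp h)
      (RunsTo.bind_ret (runsTo_push .todo x _))) (ih rfl)) (by simp; omega) rfl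
      (by simp [Store.set, Store.get])

/-! ### Writing the output -/

/-- The output symbol of a visited period. -/
def Visit.symbol (v : Visit) : OutSymbol :=
  .period v.2.2 (!v.2.1 && v.2.2) (v.2.1 && !v.2.2)

/-- Write the visited periods of the trail and tell whether a must-run flag is violated. -/
def writeTrail : Program Bool :=
  .loop (fun bad => (StackProgram.pop (Γ := Sym) .trail).bind fun
    | none => .ret (Sum.inr bad)
    | some v => (StackProgram.push .out v.symbol).bind fun _ =>
        .ret (Sum.inl (v.bad || bad))) false

theorem runsTo_writeTrail (s : Store) :
    RunsTo writeTrail s (3 * s.trail.length + 2) (s.trail.any Visit.bad)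
      { s with trail := [], out := (s.trail.map Visit.symbol).reverse ++ s.out } := by
  unfold writeTrail
  suffices H : ∀ (t : List Visit) (s : Store) (x : Bool), s.trail = t →
      RunsTo (.loop (fun bad => (StackProgram.pop (Γ := Sym) .trail).bind fun
        | none => .ret (Sum.inr bad)
        | some v => (StackProgram.push .out v.symbol).bind fun _ =>
            .ret (Sum.inl (v.bad || bad))) x) s (3 * t.length + 2) (t.any Visit.bad || x)
        { s with trail := [], out := (t.map Visit.symbol).reverse ++ s.out } from
    (H _ s false rfl).congr le_rfl (by simp) rfl
  intro t
  induction t with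
  | nil =>
    intro s x ht
    exact RunsTo.congr (RunsTo.loop_exit (RunsTo.bind (runsTo_pop_nil .trail ht)
      (runsTo_ret _ _))) (by simp) (by simp) (by
        simp only [List.map_nil, List.reverse_nil, List.nil_append]
        rw [← ht])
  | cons v t ih =>
    intro s x ht
    exact RunsTo.congr (RunsTo.loop_next (RunsTo.bind (runsTo_pop_cons .trail ht)
      (RunsTo.bind_ret (runsTo_push .out v.symbol _))) (ih _ (v.bad || x) rfl))
      (by simp; omega) (by simp [← Bool.or_assoc, Bool.or_comm]) (by simp [Store.set, Store.get])

/-! ### The whole machine -/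

/-- Compute the commitments of a generator with initial status `b` from the plan, append them to the
output, and tell whether a must-run flag is violated. -/
def finish (b : Bool) : Program Bool :=
  (copyNum b).bind fun _ => subtract.bind fun _ => (simulate b).bind fun _ =>
    writeTrail.bind fun bad => (StackProgram.move (Γ := Sym) .out .acc id).bind fun _ =>
      (StackProgram.push .acc OutSymbol.endMark).bind fun _ =>
        (StackProgram.drain (.num (some true))).bind fun _ =>
          (StackProgram.drain (.num (some false))).bind fun _ => .ret bad

/-- The commitments computed for a generator with minimum durations `N`, initial status `b`, initial
time `τ` and periods `l`. -/
def schedule (N : Bool → List Bool) (b : Bool) (τ : List Bool) (l : List (Bool × Bool)) :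
    List Visit :=
  follow N b ((subBits (N b) τ).getD []) (makePlan N l)

theorem runsTo_finish (b : Bool) {N : Option Bool → List Bool} {l : List (Bool × Bool)}
    {rest : List InSymbol} {out : List OutSymbol} {B : ℕ} (hB : ∀ j, (N j).length ≤ B) :
    RunsTo (finish b)
      { inp := rest, acc := out, num := N, plan := makePlan (fun b => N (some b)) l }
      ((l.length + 1) * (19 * B + 40) + (B + 1) * (6 * B + 50))
      ((schedule (fun b => N (some b)) b (N none) l).any Visit.bad)
      { inp := rest
        acc := .endMark ::
          (((schedule (fun b => N (some b)) b (N none) l).map Visit.symbol).reverse ++ out) } := by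
  set v := schedule (fun b => N (some b)) b (N none) l with hv
  have hvl : v.length = l.length := by rw [hv, schedule, length_follow, length_makePlan]
  have h₁ := runsTo_copyNum b (s := {
        inp := rest, acc := out, num := N
        plan := makePlan (fun b => N (some b)) l }) rfl rfl
  have h₂ := runsTo_subtract (s := {
        inp := rest, acc := out, num := N
        plan := makePlan (fun b => N (some b)) l, rem := N (some b) }) (B := B) rfl rfl (hB _)
  have h₃ := (runsTo_simulate b (s := {
        inp := rest, acc := out, num := update N none []
        plan := makePlan (fun b => N (some b)) l, rem := (subBits (N (some b)) (N none)).getD [] })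
    (B := B) rfl ((length_subBits_getD _ _).trans (max_le (hB _) (hB _)))
    (fun b => by simpa using hB (some b))).congr le_rfl rfl (s'' := {
        inp := rest, acc := out
        num := update N none [], trail := v.reverse }) (by simp [hv, schedule])
  have h₄ := (runsTo_writeTrail {
        inp := rest, acc := out, num := update N none []
        trail := v.reverse }).congr le_rfl (List.any_reverse ..) (s'' := {
        inp := rest, acc := out
        num := update N none [], out := v.map Visit.symbol }) (by simp)
  have h₅ := runsTo_move (j := .out) (k := .acc) (by simp) id {
        inp := rest, acc := out
        num := update N none [], out := v.map Visit.symbol }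
  -- All number stacks end up empty, as required for reading the next generator; `subtract` has
  -- consumed the initial time.
  have hn : update (update (update N none []) (some true) []) (some false) [] = fun _ => [] := by
    funext j
    rcases j with _ | _ | _ <;> rfl
  refine RunsTo.congr (RunsTo.bind h₁ (RunsTo.bind h₂ (RunsTo.bind h₃ (RunsTo.bind h₄
    (RunsTo.bind h₅ (RunsTo.bind (runsTo_push _ _ _) (RunsTo.bind (runsTo_drain _ _)
      (RunsTo.bind_ret (f := fun _ => v.any Visit.bad) (runsTo_drain _ _)))))))) ) ?_ rfl ?_
  · have e₁ := hB (some b)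
    have e₂ := hB none
    have e₃ := hB (some true)
    have e₄ := hB (some false)
    have e₅ : (N none).length * (6 * B + 15) ≤ B * (6 * B + 15) := Nat.mul_le_mul_right _ e₂
    simp [Store.get, Store.set, hvl, length_makePlan]
    nlinarith
  · simp [Store.get, Store.set, hn]

/-- Process a generator with initial status `b`, and tell whether a must-run flag is violated. -/
def processGenerator (b : Bool) : Program Bool :=
  (readNum (some true)).bind fun _ => (readNum (some false)).bind fun _ =>
    (readNum none).bind fun _ => readPeriods.bind fun _ => planAll.bind fun _ => finish b

/-- The minimum durations of the statuses of a generator. -/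
def minDur {T : ℕ} (γ : Generator T) (b : Bool) : ℕ := if b then γ.minRun else γ.minDown

/-- The commitments computed for a generator. -/
def generatorSchedule {T : ℕ} (γ : Generator T) (p : Fin T → Bool) : List Visit :=
  schedule (fun b => (minDur γ b).bits) γ.initOn γ.initTime.bits
    (List.ofFn fun t => (γ.mustRun t, p t))

/-- The `tail` is there because the main loop has already popped the status symbol. -/
theorem runsTo_processGenerator {T : ℕ} (γ : Generator T) (p : Fin T → Bool)
    {rest : List InSymbol} {out : List OutSymbol} :
    RunsTo (processGenerator γ.initOn)
      { inp := (encodeGenerator γ p).tail ++ rest, acc := out }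
      (400 * (encodeGenerator γ p).length ^ 3)
      ((generatorSchedule γ p).any Visit.bad)
      {
        inp := rest
        acc := ((generatorSchedule γ p).map Visit.symbol ++ [OutSymbol.endMark]).reverse ++ out } := by
  set l := List.ofFn fun t => (γ.mustRun t, p t) with hl
  have hlen : l.length = T := by simp [hl]
  have henc : (encodeGenerator γ p).tail ++ rest = encodeNumber γ.minRun ++ (encodeNumber γ.minDown ++
      (encodeNumber γ.initTime ++ (l.map (fun p => InSymbol.period p.1 p.2) ++ .endMark :: rest))) := by
    simp [encodeGenerator, hl, List.map_ofFn, Function.comp_def]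
  set N : Option Bool → List Bool := fun j => j.elim γ.initTime.bits fun b => (minDur γ b).bits with hN
  set B := max γ.initTime.bits.length (max γ.minRun.bits.length γ.minDown.bits.length) with hBdef
  have hB : ∀ j, (N j).length ≤ B := by
    rintro (_ | _ | _) <;> simp [hN, hBdef, minDur]
  have h₁ := runsTo_readNum (some true) (s := {
        inp := (encodeGenerator γ p).tail ++ rest
        acc := out }) henc rfl rfl
  have h₂ := runsTo_readNum (some false) (s := {
        inp := _, acc := out
        num := update (fun _ => []) (some true) γ.minRun.bits }) rfl rfl rfl
    (n := γ.minDown) (rest := encodeNumber γ.initTime ++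
      (l.map (fun p => InSymbol.period p.1 p.2) ++ .endMark :: rest))
  have h₃ := (runsTo_readNum none (s := {
        inp := _, acc := out
        num := update (update (fun _ => []) (some true) γ.minRun.bits) (some false) γ.minDown.bits })
      rfl rfl rfl (n := γ.initTime) (rest :=
      (l.map (fun p => InSymbol.period p.1 p.2) ++ .endMark :: rest))).congr le_rfl rfl
      (s'' := {
        inp := (l.map (fun p => InSymbol.period p.1 p.2) ++ .endMark :: rest)
        acc := out, num := N }) (by
        simp only [Store.mk.injEq, true_and, and_true]
        funext j
        rcases j with _ | _ | _ <;> simp [hN, minDur])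
  have h₄ := (runsTo_readPeriods (s := { inp := _, acc := out, num := N }) (l := l) (rest := rest) rfl).congr
    le_rfl rfl
    (s'' := { inp := rest, acc := out, num := N, todo := l.reverse }) (by simp)
  have h₅ := runsTo_planAll (s := { inp := rest, acc := out, num := N, todo := l.reverse })
    (l := l) (l' := []) (T := T) rfl rfl rfl rfl (fun b => hB (some b)) rfl rfl (by simp [hlen])
  have h₆ := runsTo_finish γ.initOn (l := l ++ []) (rest := rest) (out := out) hB
  refine RunsTo.congr (RunsTo.bind h₁ (RunsTo.bind h₂ (RunsTo.bind h₃ (RunsTo.bind h₄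
    (RunsTo.bind h₅ h₆))))) ?_ ?_ ?_
  -- Numbers contribute their digits and the periods are listed one by one, so both `B` and `T` are
  -- bounded by the length of the description.
  · have hL : (encodeGenerator γ p).length = γ.minRun.bits.length + γ.minDown.bits.length +
        γ.initTime.bits.length + T + 5 := by
      simp [encodeGenerator, encodeNumber]; ring
    set L := (encodeGenerator γ p).length
    have hBL : B + T + 5 ≤ L := by omega
    have hs : γ.minRun.bits.length + γ.minDown.bits.length + γ.initTime.bits.length ≤ L := by omega
    simp only [hlen, List.append_nil]
    have hT : T ≤ L := by omega
    have hB' : B ≤ L := by omega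
    have h1 : 1 ≤ L := by omega
    calc _ ≤ 6 * L + 12 + (3 * L + 2) + (L * (L * (84 * L + 168 * L) + 3) + 2)
          + (L * (19 * L + 40 * L) + L * (6 * L + 50 * L)) := by
          have e₁ : T * (T * (84 * B + 168) + 3) ≤ L * (L * (84 * L + 168 * L) + 3) := by
            gcongr; omega
          have e₂ : (T + 1) * (19 * B + 40) ≤ L * (19 * L + 40 * L) := by
            gcongr <;> omega
          have e₃ : (B + 1) * (6 * B + 50) ≤ L * (6 * L + 50 * L) := by
            gcongr <;> omega
          omega
      _ ≤ _ := by
          have e₂ : L ≤ L ^ 2 := by nlinarith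
          have e₃ : L ^ 2 ≤ L ^ 3 := by nlinarith
          nlinarith
  · simp [generatorSchedule, hN, hl]
  · simp [generatorSchedule, hN, hl]

/-- The machine. -/
def main : Program Unit :=
  (readNum none).bind fun _ => (StackProgram.drain (.num none)).bind fun _ =>
    (StackProgram.loop (fun bad => (StackProgram.pop (Γ := Sym) .inp).bind fun
      | some (.status b) => (processGenerator b).bind fun bad' => .ret (Sum.inl (bad || bad'))
      | _ => .ret (Sum.inr bad)) false).bind fun bad =>
        if bad then (StackProgram.drain .acc).bind fun _ => .push .out OutSymbol.infeasible
        else .move .acc .out id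

theorem runsTo_generators {T : ℕ} (l : List (Generator T × (Fin T → Bool))) (bad : Bool)
    (out : List OutSymbol) :
    RunsTo (StackProgram.loop (fun bad => (StackProgram.pop (Γ := Sym) .inp).bind fun
      | some (.status b) => (processGenerator b).bind fun bad' => .ret (Sum.inl (bad || bad'))
      | _ => .ret (Sum.inr bad)) bad)
      { inp := (l.map fun x => encodeGenerator x.1 x.2).flatten, acc := out }
      (402 * (l.map fun x => encodeGenerator x.1 x.2).flatten.length ^ 3 + 2)
      (bad || l.any fun x => (generatorSchedule x.1 x.2).any Visit.bad)
      { acc := (l.map fun x => (generatorSchedule x.1 x.2).map Visit.symbol ++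
          [OutSymbol.endMark]).flatten.reverse ++ out } := by
  induction l generalizing bad out with
  | nil =>
    exact RunsTo.congr (RunsTo.loop_exit (RunsTo.bind (runsTo_pop_nil .inp rfl)
      (runsTo_ret _ _))) (by simp) (by simp) (by simp)
  | cons x l ih =>
    have hpop : RunsTo (StackProgram.pop (Γ := Sym) .inp)
        { inp := ((x :: l).map fun x => encodeGenerator x.1 x.2).flatten, acc := out } 1
        (some (InSymbol.status x.1.initOn))
        {
        inp := (encodeGenerator x.1 x.2).tail ++ (l.map fun x => encodeGenerator x.1 x.2).flatten, acc := out } :=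
      runsTo_pop_cons .inp rfl
    refine RunsTo.congr (RunsTo.loop_next (RunsTo.bind hpop (RunsTo.bind_ret
      (runsTo_processGenerator x.1 x.2))) (ih _ _)) ?_ ?_ ?_
    · simp only [List.map_cons, List.flatten_cons, List.length_append]
      have h : 1 ≤ (encodeGenerator x.1 x.2).length := by simp [encodeGenerator]
      generalize (encodeGenerator x.1 x.2).length = a at h
      generalize ((l.map fun x => encodeGenerator x.1 x.2).flatten).length = b
      have : 1 ≤ a ^ 3 := Nat.one_le_pow _ _ h
      -- Cubes are superadditive, so the cubic bounds of the generators add up to one in the total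
      -- length. The loop overhead of 2 is absorbed by `a ^ 3`.
      have e : a ^ 3 + b ^ 3 ≤ (a + b) ^ 3 := by
        have : (a + b) ^ 3 = a ^ 3 + b ^ 3 + 3 * a * b * (a + b) := by ring
        omega
      omega
    · simp [Bool.or_assoc]
    · simp

theorem length_symbols_le {T : ℕ} (γ : Generator T) (p : Fin T → Bool) :
    ((generatorSchedule γ p).map Visit.symbol ++ [OutSymbol.endMark]).length ≤
      (encodeGenerator γ p).length := by
  simp [generatorSchedule, schedule, length_follow, length_makePlan, encodeGenerator]
  omega

/-- The output of the machine. -/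
def output {T : ℕ} (l : List (Generator T × (Fin T → Bool))) : List OutSymbol :=
  if l.any fun x => (generatorSchedule x.1 x.2).any Visit.bad then [OutSymbol.infeasible]
  else (l.map fun x => (generatorSchedule x.1 x.2).map Visit.symbol ++
    [OutSymbol.endMark]).flatten

/-- The horizon that is read first can be dropped, since end marks delimit the periods. Output is
accumulated in reverse and reversed only at the end, when it is known that no generator is
infeasible. -/
theorem runsTo_main {T : ℕ} (l : List (Generator T × (Fin T → Bool))) :
    RunsTo main { inp := encodeNumber T ++ (l.map fun x => encodeGenerator x.1 x.2).flatten }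
      (450 * ((encodeNumber T).length +
        (l.map fun x => encodeGenerator x.1 x.2).flatten.length) ^ 3)
      () { out := output l } := by
  have h₁ := runsTo_readNum none (s := {
        inp := encodeNumber T ++ (l.map fun x => encodeGenerator x.1 x.2).flatten }) rfl rfl rfl
  have h₂ := (runsTo_drain (.num none) {
        inp := (l.map fun x => encodeGenerator x.1 x.2).flatten
        num := update (fun _ => []) none T.bits }).congr le_rfl rfl
    (s'' := { inp := (l.map fun x => encodeGenerator x.1 x.2).flatten }) (by simp [Store.set])
  have h₃ := runsTo_generators l false []
  set W := (l.map fun x => (generatorSchedule x.1 x.2).map Visit.symbol ++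
          [OutSymbol.endMark]).flatten with hW
  have hWl : W.length ≤ (l.map fun x => encodeGenerator x.1 x.2).flatten.length := by
    rw [hW, List.length_flatten, List.length_flatten, List.map_map, List.map_map]
    exact List.sum_le_sum fun x _ => length_symbols_le x.1 x.2
  set L := (l.map fun x => encodeGenerator x.1 x.2).flatten.length with hL
  refine RunsTo.congr (RunsTo.bind h₁ (RunsTo.bind h₂ (RunsTo.bind h₃ (m := 3 * L + 3)
    (s'' := { out := output l }) (b := ()) ?_))) ?_ rfl rfl
  · rw [Bool.false_or]
    cases hbad : l.any fun x => (generatorSchedule x.1 x.2).any Visit.bad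
    · refine RunsTo.congr (runsTo_move (j := .acc) (k := .out) (by simp) id _) ?_ rfl ?_
      · simp [Store.get]; omega
      · simp [Store.set, Store.get, output, hbad, hW]
    · refine RunsTo.congr (RunsTo.bind (runsTo_drain .acc _) (runsTo_push .out _ _)) ?_ rfl ?_
      · simp [Store.get]; omega
      · simp [Store.set, Store.get, output, hbad]
  · have hT : (encodeNumber T).length = T.bits.length + 1 := by simp [encodeNumber]
    simp only [Store.get, update_self, hT]
    generalize T.bits.length = a
    have e : a + 1 ≤ (a + 1) ^ 3 := Nat.le_self_pow (by norm_num) _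
    have e' : L ≤ L ^ 3 := Nat.le_self_pow (by norm_num) _
    have : (a + 1 + L) ^ 3 = (a + 1) ^ 3 + L ^ 3 + 3 * (a + 1) * L * (a + 1 + L) := by ring
    omega

/-! ### Optimality of the plan -/

/-- The status of a visit. -/
def Visit.cur (v : Visit) : Bool := v.2.2

/-- The statuses `u` respect the minimum durations `M`, after status `b` which is still forced for
`r` periods. -/
def Admissible (M : Bool → ℕ) : Bool → ℕ → List Bool → Prop
  | _, _, [] => True
  | b, r, c :: u => if c = b then Admissible M b (r - 1) u else r = 0 ∧ Admissible M c (M c - 1) u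

/-- The cost of status `c` in a period, infinite if a must-run flag is violated. -/
def price (p : Bool × Bool) (c : Bool) : ℕ∞ :=
  if p.1 && !c then ⊤ else if c != p.2 then 1 else 0

/-- The cost of statuses. -/
def cost : List (Bool × Bool) → List Bool → ℕ∞
  | p :: l, c :: u => price p c + cost l u
  | _, _ => 0

/-- The cost of visits. -/
def visitCost (l : List Visit) : ℕ∞ :=
  if l.any Visit.bad then ⊤ else (l.countP Visit.miss : ℕ)

/-- Turns the flag and the count computed by the machine into a sum over periods in `ℕ∞`, to which
dynamic programming applies. -/
theorem visitCost_cons (v : Visit) (l : List Visit) :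
    visitCost (v :: l) = price v.1.1 v.cur + visitCost l := by
  unfold visitCost price
  by_cases h : v.bad = true
  · have h' : (v.1.1.1 && !v.cur) = true := h
    simp [h, h']
  · have h' : ¬ (v.1.1.1 && !v.cur) = true := h
    have e : (v.cur != v.1.1.2) = v.miss := rfl
    rw [if_neg h', e]
    by_cases hl : l.any Visit.bad = true
    · simp [h, hl]
    · by_cases hm : v.miss = true <;> simp [h, hl, hm, add_comm]

theorem visitCost_eq_cost (l : List Visit) :
    visitCost l = cost (l.map fun v => v.1.1) (l.map Visit.cur) := by
  induction l with
  | nil => simp [visitCost, cost]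
  | cons v l ih => rw [visitCost_cons, ih]; rfl

/-- Holds for every policy, optimal or not, because the counter suppresses decisions while a status
is forced. -/
theorem admissible_follow (N : Bool → List Bool) (b : Bool) (r : List Bool) (l : List PlanItem) :
    Admissible (fun b => val (N b)) b (val r) ((follow N b r l).map Visit.cur) := by
  induction l generalizing b r with
  | nil => trivial
  | cons i l ih =>
    rcases val_decBits r with ⟨h, h'⟩ | ⟨r', h, h'⟩
    · by_cases hi : i.2 b = true
      · have := ih (!b) ((decBits (N !b)).getD [])
        rw [val_decBits_getD] at this
        simpa [follow, h, hi, Visit.cur, Admissible, h'] using this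
      · simpa [follow, h, hi, Visit.cur, Admissible, h', val] using ih b []
    · have := ih b r'
      rw [show val r' = val r - 1 by omega] at this
      simpa [follow, h, Visit.cur, Admissible] using this

theorem visitCost_compare (stay change : List Visit) :
    if !change.any Visit.bad && (stay.any Visit.bad ||
      !decide (stay.countP Visit.miss < change.countP Visit.miss))
    then visitCost change ≤ visitCost stay else visitCost stay ≤ visitCost change := by
  unfold visitCost
  cases stay.any Visit.bad <;> cases change.any Visit.bad <;> simp
  exact le_of_lt

/-- Bellman's equation. With an empty counter the first period of each trial obeys its constant
policy, so its cost splits into the price of that period and the cost of the continuation. -/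
theorem decision_spec (N : Bool → List Bool) (plan : List PlanItem) (p : Bool × Bool) (b : Bool) :
    if decision N plan p b then
      price p (!b) + visitCost (follow N (!b) ((decBits (N !b)).getD []) plan) ≤
        price p b + visitCost (follow N b [] plan)
    else price p b + visitCost (follow N b [] plan) ≤
      price p (!b) + visitCost (follow N (!b) ((decBits (N !b)).getD []) plan) := by
  have h₁ : visitCost (follow N b [] ((p, fun _ => false) :: plan)) =
      price p b + visitCost (follow N b [] plan) := by
    simp [follow, decBits, visitCost_cons, Visit.cur]
  have h₂ : visitCost (follow N b [] ((p, fun _ => true) :: plan)) =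
      price p (!b) + visitCost (follow N (!b) ((decBits (N !b)).getD []) plan) := by
    simp [follow, decBits, visitCost_cons, Visit.cur]
  rw [← h₁, ← h₂]
  exact visitCost_compare _ _

/-- Bellman's principle, by induction on the periods for all statuses and counters at once: the rest
of a competitor is admissible from the state it has reached, and from there the plan is at least as
good. -/
theorem visitCost_follow_le (N : Bool → List Bool) (b : Bool) (r : List Bool)
    (l : List (Bool × Bool)) (u : List Bool) (hu : Admissible (fun b => val (N b)) b (val r) u)
    (hl : u.length = l.length) : visitCost (follow N b r (makePlan N l)) ≤ cost l u := by
  induction l generalizing b r u with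
  | nil => simp [makePlan, follow, visitCost]
  | cons p l ih =>
    obtain _ | ⟨c, u⟩ := u
    · simp at hl
    replace hl : u.length = l.length := by simpa using hl
    have hplan : makePlan N (p :: l) = (p, decision N (makePlan N l) p) :: makePlan N l := rfl
    rw [hplan, cost]
    rcases val_decBits r with ⟨h, h'⟩ | ⟨r', h, h'⟩
    · have hd := decision_spec N (makePlan N l) p b
      -- The competitor either stays or changes in this period; by induction the plan after the same
      -- first move costs no more. The decision takes the cheaper move.
      have hc : price p b + visitCost (follow N b [] (makePlan N l)) ≤ price p c + cost l u ∨
          price p (!b) + visitCost (follow N (!b) ((decBits (N !b)).getD []) (makePlan N l)) ≤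
            price p c + cost l u := by
        by_cases hcb : c = b
        · subst hcb
          left
          gcongr
          refine ih c [] u ?_ hl
          simpa [Admissible, h', val] using hu
        · obtain rfl : c = !b := Bool.eq_not.2 hcb
          right
          gcongr
          refine ih _ _ u ?_ hl
          rw [val_decBits_getD]
          simpa [Admissible, h'] using hu
      by_cases hdec : decision N (makePlan N l) p b = true
      · simp only [hdec, if_true] at hd
        simp only [follow, h, hdec, if_true, visitCost_cons]
        exact hc.elim hd.trans id
      · simp only [hdec, Bool.false_eq_true, if_false] at hd
        simp only [follow, h, hdec, Bool.false_eq_true, if_false, visitCost_cons]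
        exact hc.elim id hd.trans
    · simp only [follow, h, visitCost_cons]
      by_cases hcb : c = b
      · subst hcb
        change price p c + _ ≤ price p c + _
        gcongr
        refine ih c r' u ?_ hl
        rw [show val r' = val r - 1 by omega]
        simpa [Admissible] using hu
      -- A change while the counter is positive is not admissible.
      · simp only [Admissible, if_neg hcb] at hu
        omega

/-! ### Feasibility -/

/-- Compares the recursion on states with the constraints on pairs of periods. After a change in the
first period, its minimum duration (`t = 0` in the second condition) becomes the forced prefix of
length `M c - 1` of the remaining list; all other constraints shift by one. -/
theorem admissible_iff (M : Bool → ℕ) (b : Bool) (r : ℕ) (u : List Bool) :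
    Admissible M b r u ↔ (∀ s (hs : s < u.length), s < r → u[s] = b) ∧
      ∀ t s (ht : t < u.length) (hs : s < u.length),
        (b :: u)[t]'(Nat.lt_succ_of_lt ht) ≠ u[t] → t ≤ s → s < t + M u[t] → u[s] = u[t] := by
  induction u generalizing b r with
  | nil => simp [Admissible]
  | cons c u ih =>
    rw [Admissible]
    split_ifs with hc
    · subst hc
      rw [ih]
      constructor
      · rintro ⟨h₁, h₂⟩
        constructor
        · rintro (_ | s) hs hr
          · rfl
          · exact h₁ s (by simpa using hs) (by omega)
        · rintro (_ | t) s ht hs hne hts hsM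
          · simp at hne
          · obtain _ | s := s
            · omega
            · exact h₂ t s (by simpa using ht) (by simpa using hs) (by simpa using hne) (by omega)
                (by simp at hsM; omega)
      · rintro ⟨h₁, h₂⟩
        constructor
        · intro s hs hr
          exact h₁ (s + 1) (by simpa using hs) (by omega)
        · intro t s ht hs hne hts hsM
          exact h₂ (t + 1) (s + 1) (by simpa using ht) (by simpa using hs) (by simpa using hne)
            (by omega) (by simp; omega)
    · rw [ih]
      constructor
      · rintro ⟨rfl, h₁, h₂⟩
        refine ⟨by simp, ?_⟩
        rintro (_ | t) (_ | s) ht hs hne hts hsM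
        · rfl
        · exact h₁ s (by simpa using hs) (by simp at hsM; omega)
        · omega
        · exact h₂ t s (by simpa using ht) (by simpa using hs) (by simpa using hne) (by omega)
              (by simp at hsM; omega)
      · rintro ⟨h₁, h₂⟩
        refine ⟨?_, ?_, ?_⟩
        · by_contra hr
          exact hc (h₁ 0 (by simp) (by omega))
        · intro s hs hr
          exact h₂ 0 (s + 1) (by simp) (by simpa using hs) (by simpa using Ne.symm hc) (by omega)
            (by simp; omega)
        · intro t s ht hs hne hts hsM
          exact h₂ (t + 1) (s + 1) (by simpa using ht) (by simpa using hs) (by simpa using hne)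
            (by omega) (by simp; omega)

variable {T : ℕ}

theorem getElem_cons_ofFn (γ : Generator T) (u : Fin T → Bool) (t : Fin T) :
    (γ.initOn :: List.ofFn u)[(t : ℕ)]'(by simp) = γ.statusBefore u t := by
  obtain ⟨t, ht⟩ := t
  cases t <;> simp [Generator.statusBefore]

/-- Eliminates startups and shutdowns and treats the two statuses symmetrically. Truncated
subtraction turns the initial constraints into a forced prefix, which is empty if the minimum
duration has already elapsed. -/
theorem feasible_iff (γ : Generator T) (u v w : Fin T → Bool) :
    γ.Feasible u v w ↔ (∀ t, v t = (!γ.statusBefore u t && u t)) ∧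
      (∀ t, w t = (γ.statusBefore u t && !u t)) ∧
      Admissible (minDur γ) γ.initOn (minDur γ γ.initOn - γ.initTime) (List.ofFn u) ∧
      ∀ t, γ.mustRun t = true → u t = true := by
  have hv : (∀ t, v t = true ↔ γ.statusBefore u t = false ∧ u t = true) ↔
      ∀ t, v t = (!γ.statusBefore u t && u t) :=
    forall_congr' fun t => by cases v t <;> cases γ.statusBefore u t <;> cases u t <;> simp
  have hw : (∀ t, w t = true ↔ γ.statusBefore u t = true ∧ u t = false) ↔
      ∀ t, w t = (γ.statusBefore u t && !u t) :=
    forall_congr' fun t => by cases w t <;> cases γ.statusBefore u t <;> cases u t <;> simp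
  have hadm : Admissible (minDur γ) γ.initOn (minDur γ γ.initOn - γ.initTime) (List.ofFn u) ↔
      (∀ s : Fin T, γ.initTime + s < minDur γ γ.initOn → u s = γ.initOn) ∧
      ∀ t s : Fin T, γ.statusBefore u t ≠ u t → (t : ℕ) ≤ s → (s : ℕ) < t + minDur γ (u t) →
        u s = u t := by
    rw [admissible_iff]
    refine and_congr ⟨fun h s hs => ?_, fun h s hs hr => ?_⟩ ⟨fun h t s => ?_, fun h t s ht hs => ?_⟩
    · simpa using h s (by simp) (by omega)
    · simpa using h ⟨s, by simpa using hs⟩ (by simp; omega)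
    · have := h t s (by simp) (by simp)
      rw [getElem_cons_ofFn] at this
      simpa using this
    · have := h ⟨t, by simpa using ht⟩ ⟨s, by simpa using hs⟩
      rw [← getElem_cons_ofFn] at this
      simpa using this
  rw [hadm, ← hv, ← hw]
  constructor
  · intro h
    refine ⟨h.startup_iff, h.shutdown_iff, ⟨fun s hs => ?_, fun t s hne hts hs => ?_⟩, h.must_run⟩
    · cases hb : γ.initOn
      · exact h.init_down hb s (by simpa [minDur, hb] using hs)
      · exact h.init_run hb s (by simpa [minDur, hb] using hs)
    · cases hb : u t
      · exact h.min_down t s ((h.shutdown_iff t).2 ⟨by simpa [hb] using hne, hb⟩) hts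
          (by simpa [minDur, hb] using hs)
      · exact h.min_run t s ((h.startup_iff t).2 ⟨by simpa [hb] using hne, hb⟩) hts
          (by simpa [minDur, hb] using hs)
  · rintro ⟨h₁, h₂, ⟨h₃, h₄⟩, h₅⟩
    refine ⟨h₁, h₂, fun t s ht hts hs => ?_, fun t s ht hts hs => ?_, fun hb s hs => ?_,
      fun hb s hs => ?_, h₅⟩
    · obtain ⟨e, e'⟩ := (h₁ t).1 ht
      rw [h₄ t s (by simp [e, e']) hts (by simpa [minDur, e'] using hs), e']
    · obtain ⟨e, e'⟩ := (h₂ t).1 ht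
      rw [h₄ t s (by simp [e, e']) hts (by simpa [minDur, e'] using hs), e']
    · rw [h₃ s (by simpa [minDur, hb] using hs), hb]
    · rw [h₃ s (by simpa [minDur, hb] using hs), hb]

theorem cost_ofFn (q : Fin T → Bool × Bool) (u : Fin T → Bool) :
    cost (List.ofFn q) (List.ofFn u) = ∑ t, price (q t) (u t) := by
  induction T with
  | zero => simp [cost]
  | succ T ih => rw [List.ofFn_succ, List.ofFn_succ, cost, ih, Fin.sum_univ_succ]

/-- Respecting the must-run flags excludes infinite prices, and the others count differences. -/
theorem cost_eq_hammingDist (m p u : Fin T → Bool) (h : ∀ t, m t = true → u t = true) :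
    cost (List.ofFn fun t => (m t, p t)) (List.ofFn u) = (hammingDist u p : ℕ) := by
  rw [cost_ofFn, hammingDist, Finset.card_filter, Nat.cast_sum]
  refine Finset.sum_congr rfl fun t _ => ?_
  have : (m t && !u t) = false := by
    cases hm : m t
    · rfl
    · simp [h t hm]
  simp [price, this]

/-! ### The solution -/

theorem length_generatorSchedule (γ : Generator T) (p : Fin T → Bool) :
    (generatorSchedule γ p).length = T := by
  simp [generatorSchedule, schedule, length_follow, length_makePlan]

/-- The computed commitments of a generator. -/
def commitment (γ : Generator T) (p : Fin T → Bool) (t : Fin T) : Bool :=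
  ((generatorSchedule γ p)[(t : ℕ)]'(by simp [length_generatorSchedule])).cur

theorem ofFn_commitment (γ : Generator T) (p : Fin T → Bool) :
    List.ofFn (commitment γ p) = (generatorSchedule γ p).map Visit.cur := by
  refine List.ext_getElem (by simp [length_generatorSchedule]) fun t h h' => ?_
  simp [commitment]

theorem map_period_makePlan (N : Bool → List Bool) (l : List (Bool × Bool)) :
    (makePlan N l).map Prod.fst = l := by
  induction l with
  | nil => rfl
  | cons p l ih => exact congrArg (p :: ·) ih

theorem map_period_generatorSchedule (γ : Generator T) (p : Fin T → Bool) :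
    ((generatorSchedule γ p).map fun v => v.1.1) = List.ofFn fun t => (γ.mustRun t, p t) := by
  have : (fun v : Visit => v.1.1) = Prod.fst ∘ Prod.fst := rfl
  rw [this, ← List.map_map, generatorSchedule, schedule, map_fst_follow, map_period_makePlan]

theorem visitCost_generatorSchedule (γ : Generator T) (p : Fin T → Bool) :
    visitCost (generatorSchedule γ p) =
      cost (List.ofFn fun t => (γ.mustRun t, p t)) (List.ofFn (commitment γ p)) := by
  rw [visitCost_eq_cost, map_period_generatorSchedule, ofFn_commitment]

theorem admissible_commitment (γ : Generator T) (p : Fin T → Bool) :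
    Admissible (minDur γ) γ.initOn (minDur γ γ.initOn - γ.initTime)
      (List.ofFn (commitment γ p)) := by
  have := admissible_follow (fun b => (minDur γ b).bits) γ.initOn
    ((subBits (minDur γ γ.initOn).bits γ.initTime.bits).getD [])
    (makePlan (fun b => (minDur γ b).bits) (List.ofFn fun t => (γ.mustRun t, p t)))
  rw [val_subBits_getD] at this
  simp only [val_bits] at this
  rw [ofFn_commitment]
  exact this

theorem visitCost_generatorSchedule_le (γ : Generator T) (p u : Fin T → Bool)
    (h : Admissible (minDur γ) γ.initOn (minDur γ γ.initOn - γ.initTime) (List.ofFn u)) :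
    visitCost (generatorSchedule γ p) ≤
      cost (List.ofFn fun t => (γ.mustRun t, p t)) (List.ofFn u) := by
  refine visitCost_follow_le _ _ _ _ _ ?_ (by simp)
  rw [val_subBits_getD]
  simpa only [val_bits] using h

theorem mustRun_commitment (γ : Generator T) (p : Fin T → Bool)
    (h : (generatorSchedule γ p).any Visit.bad = false) (t : Fin T) (ht : γ.mustRun t = true) :
    commitment γ p t = true := by
  have hlt : (t : ℕ) < (generatorSchedule γ p).length := by simp [length_generatorSchedule]
  have hm := congrArg (·[(t : ℕ)]?) (map_period_generatorSchedule γ p)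
  simp only [List.getElem?_map, List.getElem?_eq_getElem hlt, Option.map_some,
    List.getElem?_ofFn, Fin.is_lt, dite_true, Fin.eta, Option.some.injEq] at hm
  have hb := List.any_eq_false.1 h _ (List.getElem_mem hlt)
  rw [Visit.bad, hm, ht] at hb
  simpa [commitment, Visit.cur] using hb

/-- The status before a visit is the status of the preceding visit, or the initial one. This makes
the startups and shutdowns written by the machine correct. -/
theorem getElem_follow (N : Bool → List Bool) (b : Bool) (r : List Bool) (l : List PlanItem)
    (t : ℕ) (ht : t < (follow N b r l).length) :
    (follow N b r l)[t].2.1 =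
      (b :: (follow N b r l).map Visit.cur)[t]'(by simpa using Nat.lt_succ_of_lt ht) := by
  induction l generalizing b r t with
  | nil => simp [follow] at ht
  | cons i l ih =>
    rcases h : decBits r with _ | r'
    · by_cases hi : i.2 b = true
      · cases t with
        | zero => simp [follow, h, hi]
        | succ t =>
          have := ih (!b) ((decBits (N !b)).getD []) t (by simpa [follow, h, hi] using ht)
          simpa [follow, h, hi, Visit.cur] using this
      · cases t with
        | zero => simp [follow, h, hi]
        | succ t =>
          have := ih b [] t (by simpa [follow, h, hi] using ht)
          simpa [follow, h, hi, Visit.cur] using this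
    · cases t with
      | zero => simp [follow, h]
      | succ t =>
        have := ih b r' t (by simpa [follow, h] using ht)
        simpa [follow, h, Visit.cur] using this

theorem map_symbol_generatorSchedule (γ : Generator T) (p : Fin T → Bool) :
    (generatorSchedule γ p).map Visit.symbol = List.ofFn fun t => OutSymbol.period
      (commitment γ p t) (!γ.statusBefore (commitment γ p) t && commitment γ p t)
      (γ.statusBefore (commitment γ p) t && !commitment γ p t) := by
  refine List.ext_getElem (by simp [length_generatorSchedule]) fun t h h' => ?_
  have ht : t < T := by simpa using h'
  have e : ((generatorSchedule γ p)[t]'(by simpa using h)).2.1 =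
      γ.statusBefore (commitment γ p) ⟨t, ht⟩ := by
    rw [← getElem_cons_ofFn]
    simp only [ofFn_commitment]
    exact getElem_follow _ _ _ _ _ _
  simp only [List.getElem_map, List.getElem_ofFn, Visit.symbol, e]
  rfl

end RepairMachine

namespace RepairInstance

open RepairMachine

/-- The computed commitment vector. -/
def repaired (I : RepairInstance) : CommitmentVector I.G I.T where
  commit g := commitment (I.gen g) (I.pred g)
  startup g t := !(I.gen g).statusBefore (commitment (I.gen g) (I.pred g)) t &&
    commitment (I.gen g) (I.pred g) t
  shutdown g t := (I.gen g).statusBefore (commitment (I.gen g) (I.pred g)) t &&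
    !commitment (I.gen g) (I.pred g) t

/-- The generators with their predicted commitments. -/
def generators (I : RepairInstance) : List (Generator I.T × (Fin I.T → Bool)) :=
  List.ofFn fun g => (I.gen g, I.pred g)

/-- The computed answer. -/
def solve (I : RepairInstance) : Option (CommitmentVector I.G I.T) :=
  if I.generators.any fun x => (generatorSchedule x.1 x.2).any Visit.bad then none
  else some I.repaired

theorem encodeAnswer_solve (I : RepairInstance) : encodeAnswer I.solve = output I.generators := by
  unfold solve output
  split_ifs
  · rfl
  · simp [encodeAnswer, CommitmentVector.encode, generators, repaired,
      map_symbol_generatorSchedule, Function.comp_def]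

theorem distance_eq_sum (I : RepairInstance) (x : CommitmentVector I.G I.T) :
    I.distance x = ∑ g, hammingDist (x.commit g) (I.pred g) := by
  simp only [distance, hammingDist, Finset.card_filter, Fintype.sum_prod_type]
  rfl

/-- A feasible vector would give the offending generator a finite cost, although the computed
schedule is cheapest and has infinite cost. -/
theorem solve_eq_none (I : RepairInstance) (h : I.solve = none) : I.feasibleSet = ∅ := by
  unfold solve at h
  split_ifs at h with hb
  rw [List.any_eq_true] at hb
  obtain ⟨_, hx, hb⟩ := hb
  obtain ⟨g, rfl⟩ := List.mem_ofFn.1 hx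
  refine Set.eq_empty_iff_forall_notMem.2 fun y hy => ?_
  obtain ⟨-, -, h₁, h₂⟩ := (feasible_iff _ _ _ _).1 (hy g)
  have := visitCost_generatorSchedule_le _ (I.pred g) _ h₁
  rw [cost_eq_hammingDist _ _ _ h₂, visitCost, if_pos hb] at this
  exact (ENat.natCast_lt_top _).not_ge this

theorem mem_optimalSet_of_solve (I : RepairInstance) (x : CommitmentVector I.G I.T)
    (h : I.solve = some x) : x ∈ I.optimalSet := by
  unfold solve at h
  split_ifs at h with hb
  obtain rfl : I.repaired = x := by simpa using h
  have hb (g : Fin I.G) : (generatorSchedule (I.gen g) (I.pred g)).any Visit.bad = false := by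
    rw [Bool.not_eq_true] at hb
    have := List.any_eq_false.1 hb _ (List.mem_ofFn.2 ⟨g, rfl⟩)
    simpa using this
  refine ⟨fun g => (feasible_iff _ _ _ _).2 ⟨fun _ => rfl, fun _ => rfl,
    admissible_commitment _ _, mustRun_commitment _ _ (hb g)⟩, fun y hy => ?_⟩
  rw [distance_eq_sum, distance_eq_sum]
  -- Optimality is checked generator by generator.
  refine Finset.sum_le_sum fun g _ => ?_
  obtain ⟨-, -, h₁, h₂⟩ := (feasible_iff _ _ _ _).1 (hy g)
  have := visitCost_generatorSchedule_le _ (I.pred g) _ h₁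
  rw [visitCost_generatorSchedule, cost_eq_hammingDist _ _ _ h₂,
    cost_eq_hammingDist _ _ _ (mustRun_commitment _ _ (hb g))] at this
  exact_mod_cast this

theorem computable_solve : Nonempty (Turing.TM2ComputableInPolyTime encode
    (id : List OutSymbol → List OutSymbol) (fun I => encodeAnswer (solve I))) := by
  refine StackProgram.computableInPolyTime (Γ := Sym) main .inp .out encode _
    (450 * Polynomial.X ^ 3) fun I => ?_
  have h := runsTo_main I.generators
  have henc : encodeNumber I.T ++ (I.generators.map fun x => encodeGenerator x.1 x.2).flatten =
      I.encode := by
    simp [encode, generators, List.map_ofFn, Function.comp_def]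
  rw [← List.length_append, henc, ← I.encodeAnswer_solve] at h
  have hget (k : Stack) (l : List (Sym k)) :
      (Store.set {} k l).get = update (fun _ => []) k l := by
    rw [Store.get_set]
    congr 1
    funext k
    cases k <;> rfl
  have h' : StackProgram.Runs main (Store.set {} .inp I.encode).get
      (450 * I.encode.length ^ 3) () (Store.set {} .out (encodeAnswer I.solve)).get := h
  rw [hget, hget] at h'
  simpa using h'

end RepairInstance

/-- The repair problem is solvable in polynomial time: some Turing machine outputs, for every
instance, an optimal repaired commitment vector, or reports that no feasible one exists, within a
number of steps that is polynomial in the length of the input string. -/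
theorem theorem1 :
    ∃ solve : (I : RepairInstance) → Option (CommitmentVector I.G I.T),
      (∀ (I : RepairInstance) (x : CommitmentVector I.G I.T),
        solve I = some x → x ∈ I.optimalSet) ∧
      (∀ I : RepairInstance, solve I = none → I.feasibleSet = ∅) ∧
      Nonempty (Turing.TM2ComputableInPolyTime RepairInstance.encode
        (id : List OutSymbol → List OutSymbol) (fun I => encodeAnswer (solve I))) :=
  ⟨RepairInstance.solve, RepairInstance.mem_optimalSet_of_solve, RepairInstance.solve_eq_none,
    RepairInstance.computable_solve⟩
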